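/- Fix integers $0\le l\le n$ and let $G=\mathrm{diag}(\varepsilon_1,\dots,\varepsilon_n)$ with $\varepsilon_i=1$ for $1\le i\le n-l$ and $\varepsilon_i=-1$ for $n-l<i\le n$. Let $R(u)=1-Pu^{-1}$, where $P=\sum_{i,j}E_{ij}\otimes E_{ji}$ is the permutation operator on $\mathbb{C}^n\otimes\mathbb{C}^n$. The Yangian $\mathrm{Y}(n)$ is the unital associative $\mathbb{C}$-algebra with generators $t_{ij}^{(r)}$ ($1\le i,j\le n$, $r\ge1$) and defining relations $$[t_{ij}(u),t_{rs}(v)]=\frac{1}{u-v}\big(t_{rj}(u)t_{is}(v)-t_{rj}(v)t_{is}(u)\big),\qquad t_{ij}(u)=\delta_{ij}+\sum_{r\ge1}t_{ij}^{(r)}u^{-r};$$ put $T(u)=(t_{ij}(u))_{i,j}$. The reflection algebra $\mathcal{B}(n,l)$ is the unital associative $\mathbb{C}$-algebra with generators $b_{ij}^{(r)}$ ($1\le i,j\le n$, $r\ge1$) and defining relations $$R(u-v)B_1(u)R(u+v)B_2(v)=B_2(v)R(u+v)B_1(u)R(u-v),\qquad B(u)B(-u)=1,$$ where $B(u)=(b_{ij}(u))_{i,j}$,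 $b_{ij}(u)=\delta_{ij}\varepsilon_i+\sum_{r\ge1}b_{ij}^{(r)}u^{-r}$, and the subscripts $1,2$ indicate the copy of $\mathrm{End}\,\mathbb{C}^n$ to which the matrix belongs. In both cases the relations are imposed on the coefficients of all monomials in $u^{-1},v^{-1}$ after clearing the denominators $u\pm v$. **Theorem.** The matrix $T(u)$ is invertible over $\mathrm{Y}(n)[[u^{-1}]]$, and there is a unique homomorphism of unital $\mathbb{C}$-algebras $\varphi:\mathcal{B}(n,l)\to\mathrm{Y}(n)$ which, applied to each coefficient of each matrix entry, sends $B(u)$ to $T(u)\,G\,T^{-1}(-u)$, where $T^{-1}(u)$ is the inverse matrix of $T(u)$. This homomorphism $\varphi$ is injective. -/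

import Mathlib

open scoped Kronecker PowerSeries

noncomputable section

namespace ReflectionAlgebra

/-! Throughout, a formal series `∑ a_r u^{-r}` with coefficients in a ring `A` is the power series
`∑ a_r X^r` in `A⟦X⟧` (so `X` stands for `u⁻¹`), and a formal series in `u⁻¹` and `v⁻¹` is an
element of `A⟦X⟧⟦X⟧` whose outer variable is `u⁻¹` and whose inner variable is `v⁻¹`. -/

section Series

variable {A : Type*} [Ring A]

/-- The substitution `u ↦ -u`, i.e. `∑ a_r u^{-r} ↦ ∑ (-1)^r a_r u^{-r}`. -/
def negArg (f : A⟦X⟧) : A⟦X⟧ :=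
  PowerSeries.mk fun r => (-1) ^ r * PowerSeries.coeff r f

/-- The series `f(u)` regarded as a series in `u⁻¹, v⁻¹`. -/
def inU : A⟦X⟧ →+* A⟦X⟧⟦X⟧ := PowerSeries.map PowerSeries.C

/-- The series `f(v)` regarded as a series in `u⁻¹, v⁻¹`. -/
def inV : A⟦X⟧ →+* A⟦X⟧⟦X⟧ := PowerSeries.C

/-- The variable `u⁻¹`. -/
def uInv : A⟦X⟧⟦X⟧ := inU PowerSeries.X

/-- The variable `v⁻¹`. -/
def vInv : A⟦X⟧⟦X⟧ := inV PowerSeries.X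

/-- The permutation matrix `P = ∑ E_ij ⊗ E_ji`. -/
def permP (n : ℕ) (S : Type*) [Ring S] : Matrix (Fin n × Fin n) (Fin n × Fin n) S :=
  Matrix.of fun p q => if p.1 = q.2 ∧ p.2 = q.1 then 1 else 0

/-- `R(u - v) = 1 - P (u - v)⁻¹` with its denominator cleared: this is
`u⁻¹ v⁻¹ (u - v) R(u - v) = (v⁻¹ - u⁻¹) - u⁻¹ v⁻¹ P`. -/
def rMinus (n : ℕ) (A : Type*) [Ring A] : Matrix (Fin n × Fin n) (Fin n × Fin n) A⟦X⟧⟦X⟧ :=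
  (vInv - uInv : A⟦X⟧⟦X⟧) • (1 : Matrix (Fin n × Fin n) (Fin n × Fin n) A⟦X⟧⟦X⟧)
    - (uInv * vInv : A⟦X⟧⟦X⟧) • permP n A⟦X⟧⟦X⟧

/-- `R(u + v) = 1 - P (u + v)⁻¹` with its denominator cleared: this is
`u⁻¹ v⁻¹ (u + v) R(u + v) = (v⁻¹ + u⁻¹) - u⁻¹ v⁻¹ P`. -/
def rPlus (n : ℕ) (A : Type*) [Ring A] : Matrix (Fin n × Fin n) (Fin n × Fin n) A⟦X⟧⟦X⟧ :=
  (vInv + uInv : A⟦X⟧⟦X⟧) • (1 : Matrix (Fin n × Fin n) (Fin n × Fin n) A⟦X⟧⟦X⟧)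
    - (uInv * vInv : A⟦X⟧⟦X⟧) • permP n A⟦X⟧⟦X⟧

/-- `M₁(u)`: the matrix `M(u)` acting in the first copy of `ℂⁿ`. -/
def firstU {n : ℕ} (M : Matrix (Fin n) (Fin n) A⟦X⟧) :
    Matrix (Fin n × Fin n) (Fin n × Fin n) A⟦X⟧⟦X⟧ :=
  M.map inU ⊗ₖ (1 : Matrix (Fin n) (Fin n) A⟦X⟧⟦X⟧)

/-- `M₂(v)`: the matrix `M(v)` acting in the second copy of `ℂⁿ`. -/
def secondV {n : ℕ} (M : Matrix (Fin n) (Fin n) A⟦X⟧) :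
    Matrix (Fin n × Fin n) (Fin n × Fin n) A⟦X⟧⟦X⟧ :=
  (1 : Matrix (Fin n) (Fin n) A⟦X⟧⟦X⟧) ⊗ₖ M.map inV

/-- `R(u-v) M₁(u) R(u+v) M₂(v)`, denominators cleared. -/
def reflectionLHS {n : ℕ} (M : Matrix (Fin n) (Fin n) A⟦X⟧) :
    Matrix (Fin n × Fin n) (Fin n × Fin n) A⟦X⟧⟦X⟧ :=
  rMinus n A * firstU M * rPlus n A * secondV M

/-- `M₂(v) R(u+v) M₁(u) R(u-v)`, denominators cleared by the same factor. -/
def reflectionRHS {n : ℕ} (M : Matrix (Fin n) (Fin n) A⟦X⟧) :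
    Matrix (Fin n × Fin n) (Fin n × Fin n) A⟦X⟧⟦X⟧ :=
  secondV M * rPlus n A * firstU M * rMinus n A

/-- `G = diag(ε₁, …, ε_n)` over a ring `S`: the first `n - l` diagonal entries are `1`, the last `l`
are `-1` (for `l ≤ n`; the index `i : Fin n` is zero-based). -/
def matG (n l : ℕ) (S : Type*) [Ring S] : Matrix (Fin n) (Fin n) S :=
  Matrix.diagonal fun i => if (i : ℕ) + l < n then 1 else -1

end Series

/-- Index set of the generators: `(i, j, r)` indexes the generator with lower indices `i, j` and
upper index `r + 1`. -/
abbrev GenIndex (n : ℕ) : Type := Fin n × Fin n × ℕ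

/-- The matrix over the free algebra with entries
`M_ij(u) = C_ij + ∑_{r ≥ 1} x_ij^{(r)} u^{-r}`, for free generators `x_ij^{(r)}` and a given constant
term `C`. -/
def genericMatrix {n : ℕ} (C : Matrix (Fin n) (Fin n) (FreeAlgebra ℂ (GenIndex n))) :
    Matrix (Fin n) (Fin n) (FreeAlgebra ℂ (GenIndex n))⟦X⟧ :=
  Matrix.of fun i j => PowerSeries.mk fun r =>
    match r with
    | 0 => C i j
    | r + 1 => FreeAlgebra.ι ℂ (i, j, r)

/-- The matrix `T(u)` of free generators, with constant term `1`. -/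
def freeT (n : ℕ) : Matrix (Fin n) (Fin n) (FreeAlgebra ℂ (GenIndex n))⟦X⟧ :=
  genericMatrix 1

/-- The matrix `B(u)` of free generators, with constant term `G`. -/
def freeB (n l : ℕ) : Matrix (Fin n) (Fin n) (FreeAlgebra ℂ (GenIndex n))⟦X⟧ :=
  genericMatrix (matG n l _)

/-- The defining relations of the Yangian: the coefficients of
`[t_ij(u), t_rs(v)] = (u - v)⁻¹ (t_rj(u) t_is(v) - t_rj(v) t_is(u))`,
multiplied by `u⁻¹ v⁻¹ (u - v) = v⁻¹ - u⁻¹`. -/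
inductive YangianRel (n : ℕ) :
    FreeAlgebra ℂ (GenIndex n) → FreeAlgebra ℂ (GenIndex n) → Prop
  | comm (i j r s : Fin n) (a b : ℕ) :
      YangianRel n
        (PowerSeries.coeff b (PowerSeries.coeff a
          ((vInv - uInv) *
            (inU (freeT n i j) * inV (freeT n r s) - inV (freeT n r s) * inU (freeT n i j)))))
        (PowerSeries.coeff b (PowerSeries.coeff a
          ((uInv * vInv) *
            (inU (freeT n r j) * inV (freeT n i s) - inV (freeT n r j) * inU (freeT n i s)))))

/-- The Yangian `Y(n)` of `gl(n)`. -/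
abbrev Yangian (n : ℕ) : Type := RingQuot (YangianRel n)

/-- The matrix `T(u)` over `Y(n)⟦u⁻¹⟧`. -/
def matT (n : ℕ) : Matrix (Fin n) (Fin n) (Yangian n)⟦X⟧ :=
  (freeT n).map (PowerSeries.map (RingQuot.mkAlgHom ℂ (YangianRel n)).toRingHom)

/-- The defining relations of the reflection algebra: the coefficients of all matrix entries of the
reflection equation `R(u-v) B₁(u) R(u+v) B₂(v) = B₂(v) R(u+v) B₁(u) R(u-v)` and of the unitary
condition `B(u) B(-u) = 1`. -/
inductive ReflectionRel (n l : ℕ) :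
    FreeAlgebra ℂ (GenIndex n) → FreeAlgebra ℂ (GenIndex n) → Prop
  | reflection (p q : Fin n × Fin n) (a b : ℕ) :
      ReflectionRel n l
        (PowerSeries.coeff b (PowerSeries.coeff a (reflectionLHS (freeB n l) p q)))
        (PowerSeries.coeff b (PowerSeries.coeff a (reflectionRHS (freeB n l) p q)))
  | unitary (i j : Fin n) (a : ℕ) :
      ReflectionRel n l
        (PowerSeries.coeff a ((freeB n l * (freeB n l).map negArg) i j))
        (PowerSeries.coeff a
          ((1 : Matrix (Fin n) (Fin n) (FreeAlgebra ℂ (GenIndex n))⟦X⟧) i j))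

/-- The reflection algebra `B(n, l)`. -/
abbrev ReflAlg (n l : ℕ) : Type := RingQuot (ReflectionRel n l)

/-- The matrix `B(u)` over `B(n, l)⟦u⁻¹⟧`. -/
def matB (n l : ℕ) : Matrix (Fin n) (Fin n) (ReflAlg n l)⟦X⟧ :=
  (freeB n l).map (PowerSeries.map (RingQuot.mkAlgHom ℂ (ReflectionRel n l)).toRingHom)

/-- `φ` sends `B(u)` to `T(u) G T⁻¹(-u)`, coefficientwise in `u⁻¹` and entrywise. -/
def SendsBToTGT (n l : ℕ) (φ : ReflAlg n l →ₐ[ℂ] Yangian n) : Prop :=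
  (matB n l).map (PowerSeries.map φ.toRingHom)
    = matT n * matG n l (Yangian n)⟦X⟧ * (Ring.inverse (matT n)).map negArg

end ReflectionAlgebra

end

/-! Existence: `R(u-v) R(v-u)` is a scalar series that is not a zero divisor, so the RTT relation
also yields exchange relations for `T(u)` and `T⁻¹(-u)`. These carry the reflection equation over
from the constant matrix `G`, which satisfies it because `G² = 1` (`reflection_matG`,
`IsRTT.reflection`). Uniqueness holds because the coefficients of `B(u)` generate.

Injectivity is a PBW-type argument run on both algebras at once. Give `b_ij^{(r)}` weight `r`. The
reflection equation makes commutators drop in weight (`commutator_mem_filt_of_reflection`). The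
unitary condition expresses half of the generators through those with `ε_j = (-1)^{r-1} ε_i`, modulo
products of generators of lower order (`coeff_matB_mem_filt`). So an element of weight at most `d`
is, modulo lower weight, an ordered version of a weighted homogeneous polynomial in these free
generators (`exists_sub_orderedProd_mem_filt`).

It remains to see that this polynomial vanishes when the element lies in the kernel, and for this
the Yangian is probed by representations. Products of commuting copies of `1 + E u⁻¹`, with `E_ij =
(λ a_i + x_i)(λ b_j + ∂_j)`, solve RTT. At top order in `λ` they become products `q` of commuting
factors' symbols `1 + a bᵀ u⁻¹`, which are scalar matrices of rank-one type. The image of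
`b_ij^{(r)}` then has degree at most `2r` in `λ`, with top coefficient the entry of `q(u) G
q(-u)⁻¹`. These entries take arbitrary values on the free generators up to any given order
(`exists_rankOneProducts_coeff_eq`). The polynomial attached to a kernel element therefore vanishes
at every point of `ℂ`-valued parameters, hence is zero, and descending induction on the weight kills
the element (`eq_zero_of_symbols`). -/

noncomputable section

namespace ReflectionAlgebra

/-! ### The substitution `u ↦ -u` -/

section NegHom

variable {A A' : Type*} [Ring A] [Ring A']

@[simp]
lemma coeff_negArg (f : A⟦X⟧) (r : ℕ) :
    PowerSeries.coeff r (negArg f) = (-1) ^ r * PowerSeries.coeff r f := by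
  simp [negArg]

@[simp]
lemma constantCoeff_negArg (f : A⟦X⟧) :
    PowerSeries.constantCoeff (negArg f) = PowerSeries.constantCoeff f := by
  rw [← PowerSeries.coeff_zero_eq_constantCoeff_apply, coeff_negArg, pow_zero, one_mul,
    PowerSeries.coeff_zero_eq_constantCoeff_apply]

/-- The substitution `u ↦ -u` as a ring homomorphism. -/
def negHom : A⟦X⟧ →+* A⟦X⟧ where
  toFun := negArg
  map_one' := by
    ext r
    rcases r with _ | r <;> simp [PowerSeries.coeff_one]
  map_zero' := by ext r; simp
  map_add' f g := by ext r; simp [mul_add]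
  map_mul' f g := by
    ext r
    simp only [coeff_negArg, PowerSeries.coeff_mul, Finset.mul_sum]
    refine Finset.sum_congr rfl fun x hx => ?_
    rw [← Finset.HasAntidiagonal.mem_antidiagonal.1 hx, pow_add, mul_assoc, mul_assoc]
    congr 1
    rw [← mul_assoc, ← mul_assoc, ((Commute.neg_one_left _).pow_left x.2).eq]

@[simp]
lemma negHom_apply (f : A⟦X⟧) : negHom f = negArg f := rfl

lemma negArg_mul (f g : A⟦X⟧) : negArg (f * g) = negArg f * negArg g := map_mul negHom f g

@[simp]
lemma negArg_negArg (f : A⟦X⟧) : negArg (negArg f) = f := by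
  ext r
  rw [coeff_negArg, coeff_negArg, ← mul_assoc, ← pow_add, Even.neg_one_pow ⟨r, rfl⟩, one_mul]

lemma map_negArg (f : A →+* A') (p : A⟦X⟧) :
    PowerSeries.map f (negArg p) = negArg (PowerSeries.map f p) := by
  ext r
  simp

lemma negArg_C (a : A) : negArg (PowerSeries.C a) = PowerSeries.C a := by
  ext r
  rcases r with _ | r <;> simp [PowerSeries.coeff_C]

lemma negArg_X : negArg (PowerSeries.X : A⟦X⟧) = -PowerSeries.X := by
  ext r
  simp only [coeff_negArg, PowerSeries.coeff_X, map_neg]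
  split_ifs with h <;> simp [h]

end NegHom

/-! ### Matrices of series and series of matrices -/

section MatEquiv

variable {A A' : Type*} [Ring A] [Ring A'] {m : Type*} [Fintype m] [DecidableEq m]

/-- Matrices of power series are power series with matrix coefficients. -/
def matEquiv : Matrix m m A⟦X⟧ ≃+* (Matrix m m A)⟦X⟧ where
  toFun M := PowerSeries.mk fun r => M.map (PowerSeries.coeff r)
  invFun p := Matrix.of fun i j => PowerSeries.mk fun r => PowerSeries.coeff r p i j
  left_inv M := by ext; simp
  right_inv p := by ext; simp
  map_add' M N := by ext; simp
  map_mul' M N := by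
    ext r i j
    simp only [PowerSeries.coeff_mk, Matrix.map_apply, Matrix.mul_apply, map_sum,
      PowerSeries.coeff_mul, Matrix.sum_apply]
    rw [Finset.sum_comm]

@[simp]
lemma coeff_matEquiv (M : Matrix m m A⟦X⟧) (r : ℕ) (i j : m) :
    PowerSeries.coeff r (matEquiv M) i j = PowerSeries.coeff r (M i j) := by
  simp [matEquiv]

@[simp]
lemma constantCoeff_matEquiv (M : Matrix m m A⟦X⟧) (i j : m) :
    PowerSeries.constantCoeff (matEquiv M) i j = PowerSeries.constantCoeff (M i j) := by
  simp only [← PowerSeries.coeff_zero_eq_constantCoeff_apply, coeff_matEquiv]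

@[simp]
lemma coeff_matEquiv_symm (p : (Matrix m m A)⟦X⟧) (r : ℕ) (i j : m) :
    PowerSeries.coeff r (matEquiv.symm p i j) = PowerSeries.coeff r p i j := by
  rw [← coeff_matEquiv, RingEquiv.apply_symm_apply]

lemma matEquiv_map_negArg (M : Matrix m m A⟦X⟧) :
    matEquiv (M.map negArg) = negArg (matEquiv M) := by
  ext r i j
  rcases Nat.even_or_odd r with h | h <;> simp [h.neg_one_pow]

lemma isUnit_of_constantCoeff_eq_one {R : Type*} [Ring R] {p : R⟦X⟧}
    (h : PowerSeries.constantCoeff p = 1) : IsUnit p :=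
  ⟨⟨p, PowerSeries.invOfUnit p 1, PowerSeries.mul_invOfUnit p 1 (by simpa using h),
    PowerSeries.invOfUnit_mul p 1 (by simpa using h)⟩, rfl⟩

lemma isUnit_of_constantCoeff_matrix {M : Matrix m m A⟦X⟧}
    (h : M.map PowerSeries.constantCoeff = 1) : IsUnit M := by
  rw [← MulEquiv.isUnit_map (matEquiv (A := A) (m := m))]
  refine isUnit_of_constantCoeff_eq_one ?_
  rw [← h]
  ext
  simp

end MatEquiv

/-! ### Series in `u⁻¹` and `v⁻¹` -/

section TwoVariables

variable {A : Type*} [Ring A] {n : ℕ}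

lemma commute_uInv (f : A⟦X⟧⟦X⟧) : Commute uInv f := by
  rw [uInv, inU, PowerSeries.map_X]
  exact (PowerSeries.commute_X f).symm

lemma commute_vInv (f : A⟦X⟧⟦X⟧) : Commute vInv f := by
  ext1 r
  rw [vInv, inV, PowerSeries.coeff_C_mul, PowerSeries.coeff_mul_C]
  exact PowerSeries.X_mul

/-- The substitution `u ↦ -u`. -/
def negU : A⟦X⟧⟦X⟧ →+* A⟦X⟧⟦X⟧ := negHom

/-- The substitution `v ↦ -v`. -/
def negV : A⟦X⟧⟦X⟧ →+* A⟦X⟧⟦X⟧ := PowerSeries.map negHom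

@[simp]
lemma negU_inU (f : A⟦X⟧) : negU (inU f) = inU (negArg f) := (map_negArg _ _).symm

@[simp]
lemma negU_inV (f : A⟦X⟧) : negU (inV f) = inV f := negArg_C f

@[simp]
lemma negV_inU (f : A⟦X⟧) : negV (inU f) = inU f := by
  ext1 r
  simp [negV, inU, negArg_C]

@[simp]
lemma negV_inV (f : A⟦X⟧) : negV (inV f) = inV (negArg f) := PowerSeries.map_C _ _

@[simp]
lemma negU_uInv : negU (uInv : A⟦X⟧⟦X⟧) = -uInv := by
  rw [uInv, negU_inU, negArg_X, map_neg]

@[simp]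
lemma negU_vInv : negU (vInv : A⟦X⟧⟦X⟧) = vInv := negU_inV _

@[simp]
lemma negV_uInv : negV (uInv : A⟦X⟧⟦X⟧) = uInv := negV_inU _

@[simp]
lemma negV_vInv : negV (vInv : A⟦X⟧⟦X⟧) = -vInv := by
  rw [vInv, negV_inV, negArg_X, map_neg]

lemma coeff_coeff_uInv_mul (f : A⟦X⟧⟦X⟧) (a b : ℕ) :
    PowerSeries.coeff b (PowerSeries.coeff (a + 1) (uInv * f)) =
      PowerSeries.coeff b (PowerSeries.coeff a f) := by
  rw [uInv, inU, PowerSeries.map_X, PowerSeries.coeff_succ_X_mul]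

lemma coeff_zero_uInv_mul (f : A⟦X⟧⟦X⟧) : PowerSeries.coeff 0 (uInv * f) = 0 := by
  rw [uInv, inU, PowerSeries.map_X, PowerSeries.coeff_zero_X_mul]

lemma coeff_coeff_vInv_mul (f : A⟦X⟧⟦X⟧) (a b : ℕ) :
    PowerSeries.coeff (b + 1) (PowerSeries.coeff a (vInv * f)) =
      PowerSeries.coeff b (PowerSeries.coeff a f) := by
  rw [vInv, inV, PowerSeries.coeff_C_mul, PowerSeries.coeff_succ_X_mul]

lemma coeff_zero_coeff_vInv_mul (f : A⟦X⟧⟦X⟧) (a : ℕ) :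
    PowerSeries.coeff 0 (PowerSeries.coeff a (vInv * f)) = 0 := by
  rw [vInv, inV, PowerSeries.coeff_C_mul, PowerSeries.coeff_zero_X_mul]

/-- `v⁻² + u⁻¹ w` is not a zero divisor. -/
lemma eq_zero_of_vInv_sq_add_uInv_mul (w f : A⟦X⟧⟦X⟧)
    (h : (vInv * vInv + uInv * w) * f = 0) : f = 0 := by
  ext1 r
  -- At order `r` in `u⁻¹`, the term `u⁻¹ w f` involves only coefficients of `f` below `r`, already
  -- zero. What is left is `v⁻² f_r = 0`, and `v⁻¹` can be cancelled.
  induction r using Nat.strong_induction_on with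
  | _ r ih =>
    have h1 := congrArg (PowerSeries.coeff r) h
    have h2 : PowerSeries.coeff r (uInv * w * f) = 0 := by
      rw [mul_assoc]
      rcases r with _ | r
      · exact coeff_zero_uInv_mul _
      · ext1 b
        rw [coeff_coeff_uInv_mul, PowerSeries.coeff_mul,
          Finset.sum_eq_zero, map_zero]
        intro x hx
        rw [ih x.2 (by have := Finset.HasAntidiagonal.mem_antidiagonal.1 hx; omega), map_zero,
          mul_zero]
    rw [add_mul, map_add, h2, add_zero, map_zero, mul_assoc, vInv, inV, PowerSeries.coeff_C_mul,
      PowerSeries.coeff_C_mul, ← mul_zero PowerSeries.X] at h1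
    rw [map_zero, ← PowerSeries.X_mul_inj, mul_zero, ← PowerSeries.X_mul_inj, h1]

end TwoVariables

/-! ### Entries of `P`, `M₁(u)`, `M₂(v)` -/

section RMatrices

variable {A : Type*} [Ring A] {n : ℕ}

@[simp]
lemma permP_mul_apply {S : Type*} [Ring S] (M : Matrix (Fin n × Fin n) (Fin n × Fin n) S)
    (p q : Fin n × Fin n) : (permP n S * M) p q = M p.swap q := by
  rw [Matrix.mul_apply, Finset.sum_eq_single p.swap]
  · simp [permP]
  · rintro x - hx
    rw [permP, Matrix.of_apply, if_neg, zero_mul]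
    rintro ⟨h1, h2⟩
    exact hx (Prod.ext h2.symm h1.symm)
  · simp

@[simp]
lemma mul_permP_apply {S : Type*} [Ring S] (M : Matrix (Fin n × Fin n) (Fin n × Fin n) S)
    (p q : Fin n × Fin n) : (M * permP n S) p q = M p q.swap := by
  rw [Matrix.mul_apply, Finset.sum_eq_single q.swap]
  · simp [permP]
  · rintro x - hx
    rw [permP, Matrix.of_apply, if_neg, mul_zero]
    rintro ⟨h1, h2⟩
    exact hx (Prod.ext h1 h2)
  · simp

lemma permP_mul_permP (S : Type*) [Ring S] : permP n S * permP n S = 1 := by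
  ext p q
  rw [permP_mul_apply]
  simp [permP, Matrix.one_apply, Prod.ext_iff, and_comm]

lemma firstU_apply (M : Matrix (Fin n) (Fin n) A⟦X⟧) (p q : Fin n × Fin n) :
    firstU M p q = if p.2 = q.2 then inU (M p.1 q.1) else 0 := by
  simp [firstU, Matrix.one_apply]

lemma secondV_apply (M : Matrix (Fin n) (Fin n) A⟦X⟧) (p q : Fin n × Fin n) :
    secondV M p q = if p.1 = q.1 then inV (M p.2 q.2) else 0 := by
  simp [secondV, Matrix.one_apply]

@[simp]
lemma firstU_mul_apply (M : Matrix (Fin n) (Fin n) A⟦X⟧)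
    (N : Matrix (Fin n × Fin n) (Fin n × Fin n) A⟦X⟧⟦X⟧) (p q : Fin n × Fin n) :
    (firstU M * N) p q = ∑ k, inU (M p.1 k) * N (k, p.2) q := by
  simp [Matrix.mul_apply, Fintype.sum_prod_type, firstU_apply]

@[simp]
lemma secondV_mul_apply (M : Matrix (Fin n) (Fin n) A⟦X⟧)
    (N : Matrix (Fin n × Fin n) (Fin n × Fin n) A⟦X⟧⟦X⟧) (p q : Fin n × Fin n) :
    (secondV M * N) p q = ∑ k, inV (M p.2 k) * N (p.1, k) q := by
  simp [Matrix.mul_apply, Fintype.sum_prod_type, secondV_apply]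

lemma firstU_mul_secondV_apply (M N : Matrix (Fin n) (Fin n) A⟦X⟧) (p q : Fin n × Fin n) :
    (firstU M * secondV N) p q = inU (M p.1 q.1) * inV (N p.2 q.2) := by
  simp [secondV_apply]

lemma secondV_mul_firstU_apply (M N : Matrix (Fin n) (Fin n) A⟦X⟧) (p q : Fin n × Fin n) :
    (secondV N * firstU M) p q = inV (N p.2 q.2) * inU (M p.1 q.1) := by
  simp [firstU_apply]

lemma firstU_mul (M N : Matrix (Fin n) (Fin n) A⟦X⟧) :
    firstU (M * N) = firstU M * firstU N := by
  ext1 p q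
  rw [firstU_mul_apply]
  simp only [firstU_apply]
  split_ifs <;> simp [Matrix.mul_apply, *]

lemma secondV_mul (M N : Matrix (Fin n) (Fin n) A⟦X⟧) :
    secondV (M * N) = secondV M * secondV N := by
  ext1 p q
  rw [secondV_mul_apply]
  simp only [secondV_apply]
  split_ifs <;> simp [Matrix.mul_apply, *]

@[simp]
lemma firstU_one : firstU (1 : Matrix (Fin n) (Fin n) A⟦X⟧) = 1 := by
  ext1 p q
  rw [firstU_apply, Matrix.one_apply, Matrix.one_apply]
  by_cases h1 : p.1 = q.1 <;> by_cases h2 : p.2 = q.2 <;> simp [h1, h2, Prod.ext_iff]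

@[simp]
lemma secondV_one : secondV (1 : Matrix (Fin n) (Fin n) A⟦X⟧) = 1 := by
  ext1 p q
  rw [secondV_apply, Matrix.one_apply, Matrix.one_apply]
  by_cases h1 : p.1 = q.1 <;> by_cases h2 : p.2 = q.2 <;> simp [h1, h2, Prod.ext_iff]

end RMatrices

/-! ### The RTT relation and its exchange forms -/

section RTT

variable {A : Type*} [Ring A] {n : ℕ}

/-- `u⁻¹` as a central element. -/
def uCen : Subring.center A⟦X⟧⟦X⟧ :=
  ⟨uInv, Subring.mem_center_iff.2 fun f => (commute_uInv f).eq.symm⟩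

/-- `v⁻¹` as a central element. -/
def vCen : Subring.center A⟦X⟧⟦X⟧ :=
  ⟨vInv, Subring.mem_center_iff.2 fun f => (commute_vInv f).eq.symm⟩

lemma uCen_smul (f : A⟦X⟧⟦X⟧) : (uCen : Subring.center A⟦X⟧⟦X⟧) • f = uInv * f := rfl

lemma vCen_smul (f : A⟦X⟧⟦X⟧) : (vCen : Subring.center A⟦X⟧⟦X⟧) • f = vInv * f := rfl

variable (n A) in
lemma rMinus_eq :
    rMinus n A = (vCen - uCen : Subring.center A⟦X⟧⟦X⟧) • 1 -
      (uCen * vCen : Subring.center A⟦X⟧⟦X⟧) • permP n A⟦X⟧⟦X⟧ := rfl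

variable (n A) in
lemma rPlus_eq :
    rPlus n A = (vCen + uCen : Subring.center A⟦X⟧⟦X⟧) • 1 -
      (uCen * vCen : Subring.center A⟦X⟧⟦X⟧) • permP n A⟦X⟧⟦X⟧ := rfl

/-- The `RTT` relation, i.e. the defining relations of the Yangian for the entries of `M`. -/
def IsRTT (M : Matrix (Fin n) (Fin n) A⟦X⟧) : Prop :=
  rMinus n A * (firstU M * secondV M) = secondV M * firstU M * rMinus n A

lemma isRTT_iff (M : Matrix (Fin n) (Fin n) A⟦X⟧) :
    IsRTT M ↔ ∀ i j r s, (vInv - uInv) *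
        (inU (M i j) * inV (M r s) - inV (M r s) * inU (M i j)) =
      (uInv * vInv) * (inU (M r j) * inV (M i s) - inV (M r j) * inU (M i s)) := by
  have key : ∀ i j r s : Fin n,
      (rMinus n A * (firstU M * secondV M)) (i, r) (j, s) =
        (secondV M * firstU M * rMinus n A) (i, r) (j, s) ↔
      (vInv - uInv) * (inU (M i j) * inV (M r s) - inV (M r s) * inU (M i j)) =
      (uInv * vInv) * (inU (M r j) * inV (M i s) - inV (M r j) * inU (M i s)) := by
    intro i j r s
    have h1 : (rMinus n A * (firstU M * secondV M)) (i, r) (j, s) =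
        (vInv - uInv) * (inU (M i j) * inV (M r s)) -
          (uInv * vInv) * (inU (M r j) * inV (M i s)) := by
      rw [rMinus_eq, sub_mul, smul_mul_assoc, smul_mul_assoc, one_mul, Matrix.sub_apply,
        Matrix.smul_apply, Matrix.smul_apply, permP_mul_apply, firstU_mul_secondV_apply,
        firstU_mul_secondV_apply]
      rfl
    have h2 : (secondV M * firstU M * rMinus n A) (i, r) (j, s) =
        (vInv - uInv) * (inV (M r s) * inU (M i j)) -
          (uInv * vInv) * (inV (M r j) * inU (M i s)) := by
      rw [rMinus_eq, mul_sub, mul_smul_comm, mul_smul_comm, mul_one, Matrix.sub_apply,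
        Matrix.smul_apply, Matrix.smul_apply, mul_permP_apply, secondV_mul_firstU_apply,
        secondV_mul_firstU_apply]
      rfl
    rw [h1, h2, mul_sub, mul_sub, sub_eq_sub_iff_sub_eq_sub]
  constructor
  · intro h i j r s
    exact (key i j r s).1 (by rw [h])
  · intro h
    ext1 ⟨i, r⟩ ⟨j, s⟩
    exact (key i j r s).2 (h i j r s)

/-- `R(v - u)`, denominators cleared. -/
def rMinusSwap (n : ℕ) (A : Type*) [Ring A] : Matrix (Fin n × Fin n) (Fin n × Fin n) A⟦X⟧⟦X⟧ :=
  (vCen - uCen : Subring.center A⟦X⟧⟦X⟧) • 1 +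
      (uCen * vCen : Subring.center A⟦X⟧⟦X⟧) • permP n A⟦X⟧⟦X⟧

lemma sq_add_mul_of_commute {S : Type*} [Ring S] {x y : S} (h : Commute x y) :
    y * y + x * (x - 2 * y - y * (x * y)) = (y - x) * (y - x) - (x * y) * (x * y) := by
  simp only [sub_mul, mul_sub, two_mul, mul_add, h.eq, mul_assoc]
  rw [h.left_comm]
  abel

/-- Since `R(u-v)` and `R(v-u)` are inverse up to the scalar `z`, multiplying RTT by `R(v-u)` on
both sides gives `z` times the claim. Modulo `u⁻¹`, `z` is `v⁻²`, so it can be cancelled. -/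
lemma IsRTT.mul_rMinusSwap {M : Matrix (Fin n) (Fin n) A⟦X⟧} (h : IsRTT M) :
    firstU M * secondV M * rMinusSwap n A = rMinusSwap n A * (secondV M * firstU M) := by
  set z : Subring.center A⟦X⟧⟦X⟧ := (vCen - uCen) * (vCen - uCen) - (uCen * vCen) * (uCen * vCen)
    with hz
  have hP := permP_mul_permP (n := n) A⟦X⟧⟦X⟧
  have h1 : rMinusSwap n A * rMinus n A = z • 1 := by
    rw [rMinus_eq, rMinusSwap]
    simp only [mul_sub, add_mul, smul_mul_assoc, mul_smul_comm, hP, one_mul, mul_one]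
    module
  have h2 : rMinus n A * rMinusSwap n A = z • 1 := by
    rw [rMinus_eq, rMinusSwap]
    simp only [mul_add, sub_mul, smul_mul_assoc, mul_smul_comm, hP, one_mul, mul_one]
    module
  have h3 : z • (firstU M * secondV M * rMinusSwap n A) =
      z • (rMinusSwap n A * (secondV M * firstU M)) := by
    calc z • (firstU M * secondV M * rMinusSwap n A)
        = (rMinusSwap n A * rMinus n A) * (firstU M * secondV M * rMinusSwap n A) := by
          rw [h1, smul_mul_assoc, one_mul]
      _ = rMinusSwap n A * (rMinus n A * (firstU M * secondV M)) * rMinusSwap n A := by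
          simp only [mul_assoc]
      _ = rMinusSwap n A * (secondV M * firstU M) * (rMinus n A * rMinusSwap n A) := by
          rw [h]
          simp only [mul_assoc]
      _ = _ := by rw [h2, mul_smul_comm, mul_one]
  rw [← sub_eq_zero, ← smul_sub] at h3
  rw [← sub_eq_zero]
  ext1 p q
  -- The witness is the `w` in `z = v⁻² + u⁻¹ w`, read off from `sq_add_mul_of_commute`.
  refine eq_zero_of_vInv_sq_add_uInv_mul
    (uInv - 2 * vInv - vInv * (uInv * vInv)) _ ?_
  have h4 := congrFun (congrFun h3 p) q
  rw [Matrix.smul_apply] at h4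
  refine Eq.trans ?_ h4
  change _ = (z : A⟦X⟧⟦X⟧) * _
  congr 1
  change _ = (vInv - uInv) * (vInv - uInv) - (uInv * vInv) * (uInv * vInv)
  exact sq_add_mul_of_commute (commute_uInv vInv)

lemma map_negU_rMinusSwap : (rMinusSwap n A).map negU = rPlus n A := by
  have h : rMinusSwap n A = (vInv - uInv : A⟦X⟧⟦X⟧) • 1 +
      (uInv * vInv : A⟦X⟧⟦X⟧) • permP n A⟦X⟧⟦X⟧ := rfl
  rw [h, rPlus]
  ext1 p q
  simp [permP, Matrix.one_apply, apply_ite negU, sub_eq_add_neg]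
  split_ifs <;> simp

lemma map_negV_rPlus : (rPlus n A).map negV = -rMinus n A := by
  rw [rPlus, rMinus]
  ext1 p q
  simp [permP, Matrix.one_apply, apply_ite negV]
  split_ifs <;> simp <;> abel

lemma map_negV_rMinus : (rMinus n A).map negV = -rPlus n A := by
  rw [rPlus, rMinus]
  ext1 p q
  simp [permP, Matrix.one_apply, apply_ite negV]
  split_ifs <;> simp <;> abel

lemma map_negU_firstU (M : Matrix (Fin n) (Fin n) A⟦X⟧) :
    (firstU M).map negU = firstU (M.map negArg) := by
  ext1 p q
  simp [firstU_apply, apply_ite negU]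

lemma map_negU_secondV (M : Matrix (Fin n) (Fin n) A⟦X⟧) :
    (secondV M).map negU = secondV M := by
  ext1 p q
  simp [secondV_apply, apply_ite negU]

lemma map_negV_firstU (M : Matrix (Fin n) (Fin n) A⟦X⟧) :
    (firstU M).map negV = firstU M := by
  ext1 p q
  simp [firstU_apply, apply_ite negV]

lemma map_negV_secondV (M : Matrix (Fin n) (Fin n) A⟦X⟧) :
    (secondV M).map negV = secondV (M.map negArg) := by
  ext1 p q
  simp [secondV_apply, apply_ite negV]

/-- The substitution `u ↦ -u` turns `R(v-u)` into `R(u+v)`; this is why the swapped form of RTT is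
needed. Sign changes in `v` then produce the remaining exchange relations. -/
lemma IsRTT.mul_rPlus {M : Matrix (Fin n) (Fin n) A⟦X⟧} (h : IsRTT M) :
    firstU (M.map negArg) * secondV M * rPlus n A =
      rPlus n A * (secondV M * firstU (M.map negArg)) := by
  have := congrArg (fun N => N.map negU) h.mul_rMinusSwap
  simpa only [Matrix.map_mul, map_negU_firstU, map_negU_secondV, map_negU_rMinusSwap] using this

lemma IsRTT.rPlus_mul {M : Matrix (Fin n) (Fin n) A⟦X⟧} (h : IsRTT M) :
    rPlus n A * (firstU M * secondV (M.map negArg)) =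
      secondV (M.map negArg) * firstU M * rPlus n A := by
  have := congrArg (fun N => N.map negV) h
  simpa only [Matrix.map_mul, map_negV_firstU, map_negV_secondV, map_negV_rMinus, mul_neg, neg_mul,
    neg_inj] using this

lemma IsRTT.neg_mul_rMinus {M : Matrix (Fin n) (Fin n) A⟦X⟧} (h : IsRTT M) :
    firstU (M.map negArg) * secondV (M.map negArg) * rMinus n A =
      rMinus n A * (secondV (M.map negArg) * firstU (M.map negArg)) := by
  have := congrArg (fun N => N.map negV) h.mul_rPlus
  simpa only [Matrix.map_mul, map_negV_firstU, map_negV_secondV, map_negV_rPlus, mul_neg, neg_mul,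
    neg_inj] using this

end RTT

/-! ### The reflection equation for `T(u) G T⁻¹(-u)` -/

section Reflection

variable {A A' : Type*} [Ring A] [Ring A'] {n : ℕ}

lemma matG_mul_matG (n l : ℕ) (S : Type*) [Ring S] : matG n l S * matG n l S = 1 := by
  rw [matG, Matrix.diagonal_mul_diagonal, ← Matrix.diagonal_one]
  congr 1
  ext i
  split_ifs <;> simp

lemma map_matG (n l : ℕ) {S S' : Type*} [Ring S] [Ring S'] (f : S →+* S') :
    (matG n l S).map f = matG n l S' := by
  rw [matG, matG, Matrix.diagonal_map (map_zero f)]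
  congr 1
  ext i
  split_ifs <;> simp

lemma firstU_matG_apply (l : ℕ) (p q : Fin n × Fin n) :
    firstU (matG n l A⟦X⟧) p q = if p = q then (if (p.1 : ℕ) + l < n then 1 else -1) else 0 := by
  simp only [firstU_apply, matG, Matrix.diagonal_apply, Prod.ext_iff]
  split_ifs <;> simp_all

lemma secondV_matG_apply (l : ℕ) (p q : Fin n × Fin n) :
    secondV (matG n l A⟦X⟧) p q = if p = q then (if (p.2 : ℕ) + l < n then 1 else -1) else 0 := by
  simp only [secondV_apply, matG, Matrix.diagonal_apply, Prod.ext_iff]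
  split_ifs <;> simp_all

lemma commute_firstU_matG_secondV (l : ℕ) (M : Matrix (Fin n) (Fin n) A⟦X⟧) :
    firstU (matG n l A⟦X⟧) * secondV M = secondV M * firstU (matG n l A⟦X⟧) := by
  ext1 p q
  rw [firstU_mul_secondV_apply, secondV_mul_firstU_apply, matG, Matrix.diagonal_apply]
  split_ifs <;> simp

lemma commute_secondV_matG_firstU (l : ℕ) (M : Matrix (Fin n) (Fin n) A⟦X⟧) :
    secondV (matG n l A⟦X⟧) * firstU M = firstU M * secondV (matG n l A⟦X⟧) := by
  ext1 p q
  rw [firstU_mul_secondV_apply, secondV_mul_firstU_apply, matG, Matrix.diagonal_apply]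
  split_ifs <;> simp

lemma permP_mul_firstU_matG (l : ℕ) :
    permP n A⟦X⟧⟦X⟧ * firstU (matG n l A⟦X⟧) = secondV (matG n l A⟦X⟧) * permP n A⟦X⟧⟦X⟧ := by
  ext1 p q
  rw [permP_mul_apply, mul_permP_apply, firstU_matG_apply, secondV_matG_apply]
  simp [Prod.ext_iff, and_comm]

lemma permP_mul_secondV_matG (l : ℕ) :
    permP n A⟦X⟧⟦X⟧ * secondV (matG n l A⟦X⟧) = firstU (matG n l A⟦X⟧) * permP n A⟦X⟧⟦X⟧ := by
  ext1 p q
  rw [permP_mul_apply, mul_permP_apply, firstU_matG_apply, secondV_matG_apply]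
  simp [Prod.ext_iff, and_comm]

/-- Moving `P` through the involutions gives `G₁ P G₂ = P = G₂ P G₁` and `P G₁ P G₂ = 1 = G₂ P G₁
P`, while `P G₁ G₂ = G₂ G₁ P`. The expanded sides agree term by term. -/
lemma reflection_aux {K R : Type*} [CommRing K] [Ring R] [Algebra K R] (d s e : K)
    {P G₁ G₂ : R} (hP : P * P = 1) (h1 : G₁ * G₁ = 1) (h2 : G₂ * G₂ = 1) (h12 : G₁ * G₂ = G₂ * G₁)
    (hP1 : P * G₁ = G₂ * P) (hP2 : P * G₂ = G₁ * P) :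
    (d • 1 - e • P) * G₁ * (s • 1 - e • P) * G₂ = G₂ * (s • 1 - e • P) * G₁ * (d • 1 - e • P) := by
  have a2 (x : R) : G₁ * (G₁ * x) = x := by rw [← mul_assoc, h1, one_mul]
  have a3 (x : R) : G₂ * (G₂ * x) = x := by rw [← mul_assoc, h2, one_mul]
  simp only [sub_mul, mul_sub, smul_mul_assoc, mul_smul_comm, mul_assoc, one_mul, mul_one, hP,
    h2, h12, hP1, hP2, a2, a3, smul_sub]
  module

lemma reflection_matG (l : ℕ) :
    reflectionLHS (matG n l A⟦X⟧) = reflectionRHS (matG n l A⟦X⟧) := by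
  rw [reflectionLHS, reflectionRHS, rMinus_eq, rPlus_eq]
  refine reflection_aux _ _ _ (permP_mul_permP _) ?_ ?_ (commute_firstU_matG_secondV _ _)
    (permP_mul_firstU_matG l) (permP_mul_secondV_matG l)
  · rw [← firstU_mul, matG_mul_matG, firstU_one]
  · rw [← secondV_mul, matG_mul_matG, secondV_one]

/-- `T(u) G T⁻¹(-u)` satisfies the reflection equation. -/
lemma IsRTT.reflection {T T' : Matrix (Fin n) (Fin n) A⟦X⟧} (h : IsRTT T) (h1 : T * T' = 1)
    (h2 : T' * T = 1) (l : ℕ) :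
    reflectionLHS (T * matG n l A⟦X⟧ * T'.map negArg) =
      reflectionRHS (T * matG n l A⟦X⟧ * T'.map negArg) := by
  have map1 : T.map negArg * T'.map negArg = 1 := by
    have := congrArg (fun N => N.map (negHom : A⟦X⟧ →+* A⟦X⟧)) h1
    rwa [Matrix.map_mul, Matrix.map_one _ (map_zero _) (map_one _)] at this
  have map2 : T'.map negArg * T.map negArg = 1 := by
    have := congrArg (fun N => N.map (negHom : A⟦X⟧ →+* A⟦X⟧)) h2
    rwa [Matrix.map_mul, Matrix.map_one _ (map_zero _) (map_one _)] at this
  have hG := reflection_matG (A := A) (n := n) l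
  have hG1 := commute_firstU_matG_secondV (A := A) l T
  have hG1' := commute_firstU_matG_secondV (A := A) l (T'.map negArg)
  have hG2 := commute_secondV_matG_firstU (A := A) l T
  have hG2' := commute_secondV_matG_firstU (A := A) l (T'.map negArg)
  have e1 : firstU (T.map negArg) * firstU (T'.map negArg) = 1 := by
    rw [← firstU_mul, map1, firstU_one]
  have e2 : firstU (T'.map negArg) * firstU (T.map negArg) = 1 := by
    rw [← firstU_mul, map2, firstU_one]
  have e3 : secondV (T.map negArg) * secondV (T'.map negArg) = 1 := by
    rw [← secondV_mul, map1, secondV_one]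
  have e4 : secondV (T'.map negArg) * secondV (T.map negArg) = 1 := by
    rw [← secondV_mul, map2, secondV_one]
  have hp := h.mul_rPlus
  have hq := h.rPlus_mul
  have hm := h.neg_mul_rMinus
  rw [reflectionLHS, reflectionRHS] at hG ⊢
  simp only [firstU_mul, secondV_mul]
  rw [IsRTT] at h
  set T₁ := firstU T
  set T₂ := secondV T
  set S₁ := firstU (T.map negArg)
  set S₂ := secondV (T.map negArg)
  set S₁' := firstU (T'.map negArg)
  set S₂' := secondV (T'.map negArg)
  set G₁ := firstU (matG n l A⟦X⟧)
  set G₂ := secondV (matG n l A⟦X⟧)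
  set R := rMinus n A
  set Q := rPlus n A
  -- `S₁'`, `S₂'` are the inverses of `S₁ = T₁(-u)`, `S₂ = T₂(-v)`. Each exchange relation is
  -- multiplied by them on both sides.
  have hp' : S₁' * Q * T₂ = T₂ * Q * S₁' := by
    calc S₁' * Q * T₂ = S₁' * (Q * (T₂ * S₁)) * S₁' := by simp only [mul_assoc, e1, mul_one]
      _ = (S₁' * S₁) * T₂ * Q * S₁' := by rw [← hp]; simp only [mul_assoc]
      _ = _ := by rw [e2, one_mul]
  have hm' : R * S₁' * S₂' = S₂' * S₁' * R := by
    calc R * S₁' * S₂' = S₂' * (S₁' * S₁) * S₂ * R * S₁' * S₂' := by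
          rw [e2, mul_one, e4, one_mul]
      _ = S₂' * S₁' * (S₁ * S₂ * R) * S₁' * S₂' := by simp only [mul_assoc]
      _ = S₂' * S₁' * R * S₂ * (S₁ * S₁') * S₂' := by rw [hm]; simp only [mul_assoc]
      _ = S₂' * S₁' * R * (S₂ * S₂') := by rw [e1, mul_one, mul_assoc]
      _ = _ := by rw [e3, mul_one]
  have hp2 : T₁ * Q * S₂' = S₂' * Q * T₁ := by
    calc T₁ * Q * S₂' = S₂' * S₂ * T₁ * Q * S₂' := by rw [e4, one_mul]
      _ = S₂' * (S₂ * T₁ * Q) * S₂' := by simp only [mul_assoc]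
      _ = S₂' * Q * T₁ * (S₂ * S₂') := by rw [← hq]; simp only [mul_assoc]
      _ = _ := by rw [e3, mul_one]
  -- Collect `T₁ T₂` on the left and `S₁' S₂'` on the right. Then `R` passes in turn through the
  -- `T`'s, the constant `G`'s and the inverses, and the factors are redistributed.
  calc R * (T₁ * G₁ * S₁') * Q * (T₂ * G₂ * S₂')
      = R * T₁ * G₁ * (S₁' * Q * T₂) * G₂ * S₂' := by simp only [mul_assoc]
    _ = R * T₁ * (G₁ * T₂) * Q * (S₁' * G₂) * S₂' := by rw [hp']; simp only [mul_assoc]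
    _ = (R * (T₁ * T₂)) * G₁ * Q * G₂ * S₁' * S₂' := by rw [hG1, ← hG2']; simp only [mul_assoc]
    _ = T₂ * T₁ * (R * G₁ * Q * G₂) * S₁' * S₂' := by rw [h]; simp only [mul_assoc]
    _ = T₂ * T₁ * G₂ * Q * G₁ * (R * S₁' * S₂') := by rw [hG]; simp only [mul_assoc]
    _ = T₂ * (T₁ * G₂) * Q * (G₁ * S₂') * S₁' * R := by rw [hm']; simp only [mul_assoc]
    _ = T₂ * G₂ * (T₁ * Q * S₂') * G₁ * S₁' * R := by
        rw [hG1', ← hG2]; simp only [mul_assoc]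
    _ = T₂ * G₂ * (S₂' * Q * T₁) * G₁ * S₁' * R := by
        rw [hp2]
    _ = _ := by simp only [mul_assoc]

end Reflection

/-! ### Change of coefficient ring -/

section Functoriality

variable {A A' : Type*} [Ring A] [Ring A'] {n : ℕ} (f : A →+* A')

/-- The extension of a ring homomorphism to series in `u⁻¹, v⁻¹`. -/
def mapUV : A⟦X⟧⟦X⟧ →+* A'⟦X⟧⟦X⟧ := PowerSeries.map (PowerSeries.map f)

@[simp]
lemma coeff_coeff_mapUV (p : A⟦X⟧⟦X⟧) (a b : ℕ) :
    PowerSeries.coeff b (PowerSeries.coeff a (mapUV f p)) =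
      f (PowerSeries.coeff b (PowerSeries.coeff a p)) := by
  simp [mapUV]

@[simp]
lemma mapUV_inU (p : A⟦X⟧) : mapUV f (inU p) = inU (PowerSeries.map f p) := by
  ext1 r
  simp [mapUV, inU]

@[simp]
lemma mapUV_inV (p : A⟦X⟧) : mapUV f (inV p) = inV (PowerSeries.map f p) :=
  PowerSeries.map_C _ _

@[simp]
lemma mapUV_uInv : mapUV f uInv = uInv := by
  rw [uInv, mapUV_inU, PowerSeries.map_X, uInv]

@[simp]
lemma mapUV_vInv : mapUV f vInv = vInv := by
  rw [vInv, mapUV_inV, PowerSeries.map_X, vInv]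

lemma map_mapUV_rMinus : (rMinus n A).map (mapUV f) = rMinus n A' := by
  rw [rMinus, rMinus]
  ext1 p q
  simp [permP, Matrix.one_apply, apply_ite (mapUV f)]

lemma map_mapUV_rPlus : (rPlus n A).map (mapUV f) = rPlus n A' := by
  rw [rPlus, rPlus]
  ext1 p q
  simp [permP, Matrix.one_apply, apply_ite (mapUV f)]

lemma map_mapUV_firstU (M : Matrix (Fin n) (Fin n) A⟦X⟧) :
    (firstU M).map (mapUV f) = firstU (M.map (PowerSeries.map f)) := by
  ext1 p q
  simp [firstU_apply, apply_ite (mapUV f)]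

lemma map_mapUV_secondV (M : Matrix (Fin n) (Fin n) A⟦X⟧) :
    (secondV M).map (mapUV f) = secondV (M.map (PowerSeries.map f)) := by
  ext1 p q
  simp [secondV_apply, apply_ite (mapUV f)]

lemma map_mapUV_reflectionLHS (M : Matrix (Fin n) (Fin n) A⟦X⟧) :
    (reflectionLHS M).map (mapUV f) = reflectionLHS (M.map (PowerSeries.map f)) := by
  simp only [reflectionLHS, Matrix.map_mul, map_mapUV_rMinus, map_mapUV_rPlus, map_mapUV_firstU,
    map_mapUV_secondV]

lemma map_mapUV_reflectionRHS (M : Matrix (Fin n) (Fin n) A⟦X⟧) :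
    (reflectionRHS M).map (mapUV f) = reflectionRHS (M.map (PowerSeries.map f)) := by
  simp only [reflectionRHS, Matrix.map_mul, map_mapUV_rMinus, map_mapUV_rPlus, map_mapUV_firstU,
    map_mapUV_secondV]

end Functoriality

/-! ### Universal properties of `Y(n)` and `B(n, l)` -/

section UniversalProperties

variable {A : Type*} [Ring A] [Algebra ℂ A] {n : ℕ}

/-- The homomorphism from the free algebra sending the generators to the coefficients of `M`. -/
def freeLift (M : Matrix (Fin n) (Fin n) A⟦X⟧) : FreeAlgebra ℂ (GenIndex n) →ₐ[ℂ] A :=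
  FreeAlgebra.lift ℂ fun g => PowerSeries.coeff (g.2.2 + 1) (M g.1 g.2.1)

lemma map_freeLift_genericMatrix (M : Matrix (Fin n) (Fin n) A⟦X⟧)
    (C : Matrix (Fin n) (Fin n) (FreeAlgebra ℂ (GenIndex n)))
    (h : M.map PowerSeries.constantCoeff = C.map (freeLift M)) :
    (genericMatrix C).map (PowerSeries.map (freeLift M).toRingHom) = M := by
  ext i j r
  rcases r with _ | r
  · have := congrFun (congrFun h i) j
    simpa [genericMatrix] using this.symm
  · simp [genericMatrix, freeLift]

lemma coeff_map_toRingHom {B : Type*} [Ring B] [Algebra ℂ B] (f : A →ₐ[ℂ] B) (p : A⟦X⟧) (r : ℕ) :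
    PowerSeries.coeff r (PowerSeries.map f.toRingHom p) = f (PowerSeries.coeff r p) := rfl

lemma algHom_ext_of_generic {Rel : FreeAlgebra ℂ (GenIndex n) → FreeAlgebra ℂ (GenIndex n) → Prop}
    {C : Matrix (Fin n) (Fin n) (FreeAlgebra ℂ (GenIndex n))} {f g : RingQuot Rel →ₐ[ℂ] A}
    (h : ((genericMatrix C).map (PowerSeries.map (RingQuot.mkAlgHom ℂ Rel).toRingHom)).map
        (PowerSeries.map f.toRingHom) =
      ((genericMatrix C).map (PowerSeries.map (RingQuot.mkAlgHom ℂ Rel).toRingHom)).map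
        (PowerSeries.map g.toRingHom)) : f = g := by
  apply RingQuot.ringQuot_ext'
  apply FreeAlgebra.hom_ext
  funext ⟨i, j, r⟩
  have := congrArg (PowerSeries.coeff (r + 1)) (congrFun (congrFun h i) j)
  simp only [Matrix.map_apply, coeff_map_toRingHom, genericMatrix, Matrix.of_apply,
    PowerSeries.coeff_mk] at this
  exact this

lemma isRTT_matT (n : ℕ) : IsRTT (matT n) := by
  rw [isRTT_iff]
  intro i j r s
  ext a b
  have := RingQuot.mkAlgHom_rel ℂ (YangianRel.comm i j r s a b)
  have key (p) : RingQuot.mkAlgHom ℂ (YangianRel n) (PowerSeries.coeff b (PowerSeries.coeff a p)) =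
      PowerSeries.coeff b (PowerSeries.coeff a
        (mapUV (RingQuot.mkAlgHom ℂ (YangianRel n)).toRingHom p)) := by
    rw [coeff_coeff_mapUV]; rfl
  rw [key, key] at this
  simp only [map_mul, map_sub, mapUV_vInv, mapUV_uInv, mapUV_inU, mapUV_inV] at this
  exact this

lemma constantCoeff_matT (n : ℕ) : (matT n).map PowerSeries.constantCoeff = 1 := by
  ext i j
  have : PowerSeries.constantCoeff (matT n i j) =
    RingQuot.mkAlgHom ℂ (YangianRel n) ((1 : Matrix _ _ (FreeAlgebra ℂ (GenIndex n))) i j) := by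
    rw [← PowerSeries.coeff_zero_eq_constantCoeff_apply]
    simp only [matT, Matrix.map_apply, coeff_map_toRingHom, freeT, genericMatrix, Matrix.of_apply,
      PowerSeries.coeff_mk]
  rw [Matrix.map_apply, this, Matrix.one_apply, Matrix.one_apply]
  split_ifs <;> simp

lemma exists_yangian_lift {M : Matrix (Fin n) (Fin n) A⟦X⟧} (h : IsRTT M)
    (h1 : M.map PowerSeries.constantCoeff = 1) :
    ∃ f : Yangian n →ₐ[ℂ] A, (matT n).map (PowerSeries.map f.toRingHom) = M := by
  have hM := map_freeLift_genericMatrix M 1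
    (by rw [h1, Matrix.map_one _ (map_zero _) (map_one _)])
  have hM' (i j) : PowerSeries.map (freeLift M).toRingHom (freeT n i j) = M i j :=
    congrFun (congrFun hM i) j
  have key (p) (a b) : freeLift M (PowerSeries.coeff b (PowerSeries.coeff a p)) =
      PowerSeries.coeff b (PowerSeries.coeff a (mapUV (freeLift M).toRingHom p)) := by
    rw [coeff_coeff_mapUV]; rfl
  refine ⟨RingQuot.liftAlgHom ℂ ⟨freeLift M, ?_⟩, ?_⟩
  · rintro _ _ ⟨i, j, r, s, a, b⟩
    rw [key, key]
    simp only [map_mul, map_sub, mapUV_vInv, mapUV_uInv, mapUV_inU, mapUV_inV, hM']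
    rw [(isRTT_iff M).1 h]
  · refine Eq.trans ?_ hM
    ext i j r
    simp only [Matrix.map_apply, coeff_map_toRingHom, matT, freeT]
    exact RingQuot.liftAlgHom_mkAlgHom_apply _ _ _ _

lemma reflection_matB (n l : ℕ) : reflectionLHS (matB n l) = reflectionRHS (matB n l) := by
  rw [matB, ← map_mapUV_reflectionLHS, ← map_mapUV_reflectionRHS]
  ext p q a b
  rw [Matrix.map_apply, Matrix.map_apply, coeff_coeff_mapUV, coeff_coeff_mapUV]
  exact RingQuot.mkAlgHom_rel ℂ (ReflectionRel.reflection p q a b)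

lemma map_map_negArg {A A' : Type*} [Ring A] [Ring A'] (f : A →+* A')
    (M : Matrix (Fin n) (Fin n) A⟦X⟧) :
    (M.map negArg).map (PowerSeries.map f) = (M.map (PowerSeries.map f)).map negArg := by
  ext1 i j
  simp [map_negArg]

lemma unitary_matB (n l : ℕ) : matB n l * (matB n l).map negArg = 1 := by
  rw [matB, ← map_map_negArg, ← Matrix.map_mul,
    ← Matrix.map_one _ (map_zero (PowerSeries.map
      (RingQuot.mkAlgHom ℂ (ReflectionRel n l)).toRingHom)) (map_one _)]
  ext i j a
  rw [Matrix.map_apply, Matrix.map_apply, coeff_map_toRingHom, coeff_map_toRingHom]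
  exact RingQuot.mkAlgHom_rel ℂ (ReflectionRel.unitary i j a)

lemma constantCoeff_matB (n l : ℕ) : (matB n l).map PowerSeries.constantCoeff = matG n l _ := by
  rw [← map_matG n l (RingQuot.mkAlgHom ℂ (ReflectionRel n l)).toRingHom]
  ext i j
  rw [Matrix.map_apply, Matrix.map_apply, ← PowerSeries.coeff_zero_eq_constantCoeff_apply]
  simp [matB, freeB, genericMatrix]

lemma exists_reflAlg_lift {l : ℕ} {M : Matrix (Fin n) (Fin n) A⟦X⟧}
    (h : reflectionLHS M = reflectionRHS M) (h1 : M.map PowerSeries.constantCoeff = matG n l A)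
    (h2 : M * M.map negArg = 1) :
    ∃ f : ReflAlg n l →ₐ[ℂ] A, (matB n l).map (PowerSeries.map f.toRingHom) = M := by
  have hM := map_freeLift_genericMatrix M (matG n l _)
    (by rw [h1]; exact (map_matG n l (freeLift M).toRingHom).symm)
  refine ⟨RingQuot.liftAlgHom ℂ ⟨freeLift M, ?_⟩, ?_⟩
  · rintro _ _ (⟨p, q, a, b⟩ | ⟨i, j, a⟩)
    · have e : (reflectionLHS (freeB n l)).map (mapUV (freeLift M).toRingHom) =
          (reflectionRHS (freeB n l)).map (mapUV (freeLift M).toRingHom) := by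
        rw [map_mapUV_reflectionLHS, map_mapUV_reflectionRHS, freeB, hM, h]
      have := congrArg (fun N => PowerSeries.coeff b (PowerSeries.coeff a (N p q))) e
      simp only [Matrix.map_apply, coeff_coeff_mapUV] at this
      exact this
    · have : (freeB n l * (freeB n l).map negArg).map (PowerSeries.map (freeLift M).toRingHom) =
          (1 : Matrix _ _ (FreeAlgebra ℂ (GenIndex n))⟦X⟧).map
            (PowerSeries.map (freeLift M).toRingHom) := by
        rw [Matrix.map_mul, map_map_negArg, freeB, hM, h2,
          Matrix.map_one _ (map_zero _) (map_one _)]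
      have := congrArg (fun N => PowerSeries.coeff a (N i j)) this
      simpa only [Matrix.map_apply, coeff_map_toRingHom] using this
  · refine Eq.trans ?_ hM
    ext i j r
    simp only [Matrix.map_apply, coeff_map_toRingHom, matB, freeB]
    exact RingQuot.liftAlgHom_mkAlgHom_apply _ _ _ _

/-- `T(u) G T⁻¹(-u)` satisfies the unitary condition. -/
lemma unitary_of_inverse {A : Type*} [Ring A] {T T' : Matrix (Fin n) (Fin n) A⟦X⟧}
    (h1 : T * T' = 1) (h2 : T' * T = 1) (l : ℕ) :
    (T * matG n l A⟦X⟧ * T'.map negArg) *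
      (T * matG n l A⟦X⟧ * T'.map negArg).map negArg = 1 := by
  have h3 : T'.map negArg * T.map negArg = 1 := by
    have := congrArg (fun N => N.map (negHom : A⟦X⟧ →+* A⟦X⟧)) h2
    rwa [Matrix.map_mul, Matrix.map_one _ (map_zero _) (map_one _)] at this
  have h4 : (T * matG n l A⟦X⟧ * T'.map negArg).map negArg =
      T.map negArg * matG n l A⟦X⟧ * T' := by
    have h5 : (T'.map negArg).map (negHom : A⟦X⟧ →+* A⟦X⟧) = T' := by
      ext1 i j
      simp
    change (T * matG n l A⟦X⟧ * T'.map negArg).map (negHom : A⟦X⟧ →+* A⟦X⟧) = _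
    rw [Matrix.map_mul, Matrix.map_mul, map_matG, h5]
    rfl
  rw [h4]
  calc _ = T * matG n l A⟦X⟧ * (T'.map negArg * T.map negArg) * matG n l A⟦X⟧ * T' := by
        simp only [mul_assoc]
    _ = T * (matG n l A⟦X⟧ * matG n l A⟦X⟧) * T' := by rw [h3, mul_one]; simp only [mul_assoc]
    _ = 1 := by rw [matG_mul_matG, mul_one, h1]

end UniversalProperties

/-! ### Weight filtration and ordered monomials -/

section Filtration

variable {B ι : Type*} [Ring B] (b : ι → B) (wt : ι → ℕ)

/-- The product of the elements of a family along a word. -/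
def wordProd (w : List ι) : B := (w.map b).prod

/-- The weight of a word. -/
def wordWt (w : List ι) : ℕ := (w.map wt).sum

@[simp]
lemma wordProd_nil : wordProd b [] = 1 := rfl

@[simp]
lemma wordProd_cons (g : ι) (w : List ι) : wordProd b (g :: w) = b g * wordProd b w := by
  simp [wordProd]

variable [Algebra ℂ B]

/-- The span of the words of weight less than `d`. -/
def filt (d : ℕ) : Submodule ℂ B :=
  Submodule.span ℂ (wordProd b '' {w | wordWt wt w < d})

variable {b wt}

@[simp]
lemma wordWt_nil : wordWt wt [] = 0 := rfl

@[simp]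
lemma wordWt_cons (g : ι) (w : List ι) : wordWt wt (g :: w) = wt g + wordWt wt w := by
  simp [wordWt]

lemma wordProd_mem_filt {w : List ι} {d : ℕ} (h : wordWt wt w < d) :
    wordProd b w ∈ filt b wt d :=
  Submodule.subset_span ⟨w, h, rfl⟩

lemma filt_mono {d d' : ℕ} (h : d ≤ d') : filt b wt d ≤ filt b wt d' :=
  Submodule.span_mono (Set.image_mono fun _ hw => lt_of_lt_of_le hw h)

lemma filt_zero : filt b wt 0 = ⊥ := by
  simp [filt]

/-- The bounds are strict: weights at most `c - 1` and `d - 1` add up to at most `c + d - 2`, so one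
unit is gained. -/
lemma mul_mem_filt {x y : B} {c d e : ℕ} (hx : x ∈ filt b wt c) (hy : y ∈ filt b wt d)
    (h : c + d ≤ e + 1) : x * y ∈ filt b wt e := by
  have h1 : filt b wt c * filt b wt d ≤ filt b wt e := by
    rw [filt, filt, Submodule.span_mul_span, Submodule.span_le]
    rintro _ ⟨_, ⟨w, hw, rfl⟩, _, ⟨w', hw', rfl⟩, rfl⟩
    have : wordProd b w * wordProd b w' = wordProd b (w ++ w') := by simp [wordProd]
    change wordProd b w * wordProd b w' ∈ _
    rw [this]
    refine wordProd_mem_filt ?_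
    simp only [Set.mem_ofPred_eq] at hw hw'
    have : wordWt wt (w ++ w') = wordWt wt w + wordWt wt w' := by simp [wordWt]
    omega
  exact h1 (Submodule.mul_mem_mul hx hy)

lemma one_mem_filt {d : ℕ} (h : 0 < d) : (1 : B) ∈ filt b wt d :=
  wordProd_mem_filt (w := []) h

lemma basic_mem_filt (g : ι) : b g ∈ filt b wt (wt g + 1) := by
  have := wordProd_mem_filt (b := b) (wt := wt) (w := [g]) (d := wt g + 1) (by simp)
  simpa using this

lemma wordWt_perm {w w' : List ι} (h : w.Perm w') : wordWt wt w = wordWt wt w' :=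
  (h.map wt).sum_eq

/-- Hypothesis `hc` says that the associated graded algebra is commutative. A permutation is built
from adjacent swaps, each costing a commutator of smaller weight. -/
lemma wordProd_sub_mem_filt_of_perm
    (hc : ∀ g h, b g * b h - b h * b g ∈ filt b wt (wt g + wt h)) {w w' : List ι}
    (h : w.Perm w') : wordProd b w - wordProd b w' ∈ filt b wt (wordWt wt w) := by
  induction h with
  | nil => simp
  | cons g _ ih =>
    rw [wordProd_cons, wordProd_cons, ← mul_sub]
    exact mul_mem_filt (basic_mem_filt g) ih (by simp; omega)
  | swap g h w =>
    have : wordProd b (h :: g :: w) - wordProd b (g :: h :: w) =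
        (b h * b g - b g * b h) * wordProd b w := by
      simp [sub_mul, mul_assoc]
    rw [this]
    exact mul_mem_filt (hc h g) (wordProd_mem_filt (Nat.lt_succ_self _)) (by simp; omega)
  | trans h1 _ ih1 ih2 =>
    rw [← sub_add_sub_cancel]
    refine add_mem ih1 ?_
    rwa [wordWt_perm h1]

variable (b) in
/-- The linear map sending each monomial to the product of its factors, in some order. -/
def orderedProd : MvPolynomial ι ℂ →ₗ[ℂ] B :=
  (MvPolynomial.basisMonomials ι ℂ).constr ℂ fun m => wordProd b (Finsupp.toMultiset m).toList

lemma orderedProd_monomial (m : ι →₀ ℕ) (c : ℂ) :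
    orderedProd b (MvPolynomial.monomial m c) =
      c • wordProd b (Finsupp.toMultiset m).toList := by
  have : MvPolynomial.monomial m c = c • MvPolynomial.basisMonomials ι ℂ m := by
    simp [MvPolynomial.smul_monomial]
  rw [this, map_smul, orderedProd, Module.Basis.constr_basis]

lemma wordWt_toList (m : ι →₀ ℕ) :
    wordWt wt (Finsupp.toMultiset m).toList = Finsupp.weight wt m := by
  rw [wordWt, ← Multiset.sum_coe, ← Multiset.map_coe, Multiset.coe_toList]
  induction m using Finsupp.induction_linear with
  | zero => simp
  | add f g hf hg => simp [hf, hg]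
  | single i k => simp [Multiset.map_nsmul, Finsupp.weight_single, Multiset.sum_nsmul]

lemma prod_map_toList (τ : ι → ℂ) (m : ι →₀ ℕ) :
    ((Finsupp.toMultiset m).toList.map τ).prod =
      MvPolynomial.eval τ (MvPolynomial.monomial m 1) := by
  rw [← Multiset.prod_coe, ← Multiset.map_coe, Multiset.coe_toList]
  induction m using Finsupp.induction_linear with
  | zero => simp
  | add f g hf hg =>
    rw [map_add, Multiset.map_add, Multiset.prod_add, hf, hg, ← map_mul,
      MvPolynomial.monomial_mul, one_mul]
  | single i k => simp [Multiset.map_nsmul, MvPolynomial.eval_monomial, Multiset.prod_nsmul]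

/-- The spanning half of a PBW theorem. The order chosen inside each monomial is immaterial, because
reordering changes only lower weight. -/
lemma exists_sub_orderedProd_mem_filt
    (hc : ∀ g h, b g * b h - b h * b g ∈ filt b wt (wt g + wt h)) {d : ℕ} {z : B}
    (hz : z ∈ filt b wt (d + 1)) :
    ∃ f : MvPolynomial ι ℂ, f.IsWeightedHomogeneous wt d ∧ z - orderedProd b f ∈ filt b wt d := by
  classical
  induction hz using Submodule.span_induction with
  | mem x hx =>
    obtain ⟨w, hw, rfl⟩ := hx
    rcases (Nat.lt_succ_iff.1 hw).lt_or_eq with h | h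
    · exact ⟨0, MvPolynomial.isWeightedHomogeneous_zero _ _ _, by
        simpa using wordProd_mem_filt h⟩
    · have hp : w.Perm (Finsupp.toMultiset (Multiset.toFinsupp (w : Multiset ι))).toList := by
        rw [← Multiset.coe_eq_coe, Multiset.coe_toList, Multiset.toFinsupp_toMultiset]
      refine ⟨MvPolynomial.monomial (Multiset.toFinsupp (w : Multiset ι)) 1,
        MvPolynomial.isWeightedHomogeneous_monomial _ _ _ ?_, ?_⟩
      · rw [← wordWt_toList, ← wordWt_perm hp, h]
      · rw [orderedProd_monomial, one_smul, ← h]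
        exact wordProd_sub_mem_filt_of_perm hc hp
  | zero => exact ⟨0, MvPolynomial.isWeightedHomogeneous_zero _ _ _, by simp⟩
  | add x y _ _ hx hy =>
    obtain ⟨f, hf, hf'⟩ := hx
    obtain ⟨g, hg, hg'⟩ := hy
    refine ⟨f + g, hf.add hg, ?_⟩
    rw [map_add, add_sub_add_comm]
    exact add_mem hf' hg'
  | smul c x _ hx =>
    obtain ⟨f, hf, hf'⟩ := hx
    refine ⟨c • f, ?_, ?_⟩
    · exact (MvPolynomial.weightedHomogeneousSubmodule ℂ wt d).smul_mem c hf
    · rw [map_smul, ← smul_sub]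
      exact Submodule.smul_mem _ _ hf'

end Filtration

/-! ### Leading coefficients in `λ` -/

section Symbols

variable {A : Type*} [Ring A] [Algebra ℂ A]

/-- A polynomial has degree at most `2 r`, with coefficient `c` there. -/
def HasSymbol (p : Polynomial A) (r : ℕ) (c : ℂ) : Prop :=
  p.natDegree ≤ 2 * r ∧ p.coeff (2 * r) = algebraMap ℂ A c

lemma HasSymbol.mul {p q : Polynomial A} {r s : ℕ} {c d : ℂ} (hp : HasSymbol p r c)
    (hq : HasSymbol q s d) : HasSymbol (p * q) (r + s) (c * d) := by
  refine ⟨?_, ?_⟩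
  · have := Polynomial.natDegree_mul_le (p := p) (q := q)
    have := hp.1
    have := hq.1
    omega
  · rw [mul_add, Polynomial.coeff_mul_add_eq_of_natDegree_le hp.1 hq.1, hp.2, hq.2, map_mul]

lemma HasSymbol.add {p q : Polynomial A} {r : ℕ} {c d : ℂ} (hp : HasSymbol p r c)
    (hq : HasSymbol q r d) : HasSymbol (p + q) r (c + d) :=
  ⟨(Polynomial.natDegree_add_le _ _).trans (max_le hp.1 hq.1), by
    rw [Polynomial.coeff_add, hp.2, hq.2, map_add]⟩

lemma hasSymbol_zero (r : ℕ) : HasSymbol (0 : Polynomial A) r 0 := by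
  simp [HasSymbol]

lemma hasSymbol_algebraMap (c : ℂ) : HasSymbol (algebraMap ℂ (Polynomial A) c) 0 c := by
  rw [Polynomial.algebraMap_apply]
  simp [HasSymbol]

lemma hasSymbol_one : HasSymbol (1 : Polynomial A) 0 1 := by
  simpa using hasSymbol_algebraMap (A := A) 1

lemma HasSymbol.smul {p : Polynomial A} {r : ℕ} {c : ℂ} (d : ℂ) (hp : HasSymbol p r c) :
    HasSymbol (d • p) r (d * c) := by
  rw [Algebra.smul_def]
  simpa using (hasSymbol_algebraMap d).mul hp

lemma HasSymbol.neg {p : Polynomial A} {r : ℕ} {c : ℂ} (hp : HasSymbol p r c) :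
    HasSymbol (-p) r (-c) := by
  simpa using hp.smul (-1)

lemma HasSymbol.lt {p : Polynomial A} {r s : ℕ} {c : ℂ} (hp : HasSymbol p r c) (h : r < s) :
    HasSymbol p s 0 :=
  ⟨hp.1.trans (by omega), by
    rw [Polynomial.coeff_eq_zero_of_natDegree_lt (lt_of_le_of_lt hp.1 (by omega)), map_zero]⟩

lemma HasSymbol.sum {κ : Type*} {s : Finset κ} {p : κ → Polynomial A} {r : ℕ} {c : κ → ℂ}
    (h : ∀ k ∈ s, HasSymbol (p k) r (c k)) : HasSymbol (∑ k ∈ s, p k) r (∑ k ∈ s, c k) := by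
  classical
  induction s using Finset.induction_on with
  | empty => exact hasSymbol_zero r
  | insert k s hk ih =>
    rw [Finset.sum_insert hk, Finset.sum_insert hk]
    exact (h k (Finset.mem_insert_self _ _)).add
      (ih fun j hj => h j (Finset.mem_insert_of_mem hj))

variable {B ι : Type*} [Ring B] [Algebra ℂ B] {b : ι → B} {wt : ι → ℕ}

/-- A word of weight at most `d` has only letters of weight at most `d`, so symbols need to be
controlled only up to that weight. -/
lemma hasSymbol_wordProd {f : B →ₐ[ℂ] Polynomial A} {τ : ι → ℂ} {d : ℕ}
    (hf : ∀ g, wt g ≤ d → HasSymbol (f (b g)) (wt g) (τ g)) (w : List ι) (hw : wordWt wt w ≤ d) :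
    HasSymbol (f (wordProd b w)) (wordWt wt w) (w.map τ).prod := by
  induction w with
  | nil => simpa using hasSymbol_one
  | cons g w ih =>
    rw [wordWt_cons] at hw
    rw [wordProd_cons, map_mul, wordWt_cons, List.map_cons, List.prod_cons]
    exact (hf g (by omega)).mul (ih (by omega))

lemma hasSymbol_of_mem_filt {f : B →ₐ[ℂ] Polynomial A} {τ : ι → ℂ} {d : ℕ}
    (hf : ∀ g, wt g ≤ d → HasSymbol (f (b g)) (wt g) (τ g)) {z : B} (hz : z ∈ filt b wt d) :
    HasSymbol (f z) d 0 := by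
  induction hz using Submodule.span_induction with
  | mem x hx =>
    obtain ⟨w, hw, rfl⟩ := hx
    exact (hasSymbol_wordProd hf w (le_of_lt hw)).lt hw
  | zero => simpa using hasSymbol_zero d
  | add x y _ _ hx hy => simpa using hx.add hy
  | smul c x _ hx => simpa using hx.smul c

lemma hasSymbol_orderedProd {f : B →ₐ[ℂ] Polynomial A} {τ : ι → ℂ} {d : ℕ}
    (hf : ∀ g, wt g ≤ d → HasSymbol (f (b g)) (wt g) (τ g)) {p : MvPolynomial ι ℂ}
    (hp : p.IsWeightedHomogeneous wt d) :
    HasSymbol (f (orderedProd b p)) d (MvPolynomial.eval τ p) := by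
  rw [← MvPolynomial.support_sum_monomial_coeff p, map_sum, map_sum, map_sum]
  refine HasSymbol.sum fun m hm => ?_
  have hw : wordWt wt (Finsupp.toMultiset m).toList = d := by
    rw [wordWt_toList]
    exact hp (MvPolynomial.mem_support_iff.1 hm)
  have h := (hasSymbol_wordProd hf _ hw.le).smul (p.coeff m)
  rw [hw, prod_map_toList] at h
  rw [orderedProd_monomial, map_smul]
  convert h using 1
  simp [MvPolynomial.eval_monomial]

/-- If homomorphisms with arbitrary prescribed symbols kill `z`, then `z = 0`. -/
lemma eq_zero_of_symbols [Nontrivial A]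
    (hc : ∀ g h, b g * b h - b h * b g ∈ filt b wt (wt g + wt h)) {z : B}
    (hz : ∀ (d : ℕ) (τ : ι → ℂ), ∃ f : B →ₐ[ℂ] Polynomial A, f z = 0 ∧
      ∀ g, wt g ≤ d → HasSymbol (f (b g)) (wt g) (τ g)) (d : ℕ) (hd : z ∈ filt b wt d) :
    z = 0 := by
  induction d with
  | zero => simpa [filt_zero] using hd
  | succ d ih =>
    obtain ⟨p, hp, hp'⟩ := exists_sub_orderedProd_mem_filt hc hd
    have : p = 0 := by
      -- As `f z = 0`, the `λ^{2d}` coefficient of the image of the ordered polynomial is both zero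
      -- and the value of `p` at `τ`. A complex polynomial vanishing at all `τ` is zero.
      refine MvPolynomial.funext fun τ => ?_
      obtain ⟨f, hf, hf'⟩ := hz d τ
      have h1 := hasSymbol_of_mem_filt hf' hp'
      have h2 := hasSymbol_orderedProd hf' hp
      rw [map_sub, hf, zero_sub] at h1
      have h3 := (h1.add h2).2
      rw [neg_add_cancel, Polynomial.coeff_zero, zero_add, eq_comm] at h3
      rw [map_zero]
      exact (map_eq_zero (algebraMap ℂ A)).1 h3
    rw [this, map_zero, sub_zero] at hp'
    exact ih hp'

end Symbols

/-! ### Commutators drop in weight -/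

section FilteredSeries

section

variable {B : Type*} [Ring B]

lemma coeff_coeff_inU_mul_inV (f g : B⟦X⟧) (r s : ℕ) :
    PowerSeries.coeff s (PowerSeries.coeff r (inU f * inV g)) =
      PowerSeries.coeff r f * PowerSeries.coeff s g := by
  rw [inV, PowerSeries.coeff_mul_C, inU, PowerSeries.coeff_map, PowerSeries.coeff_C_mul]

lemma coeff_coeff_inV_mul_inU (f g : B⟦X⟧) (r s : ℕ) :
    PowerSeries.coeff s (PowerSeries.coeff r (inV g * inU f)) =
      PowerSeries.coeff s g * PowerSeries.coeff r f := by
  rw [inV, PowerSeries.coeff_C_mul, inU, PowerSeries.coeff_map, PowerSeries.coeff_mul_C]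

end

variable {B ι : Type*} [Ring B] [Algebra ℂ B] (b : ι → B) (wt : ι → ℕ)

/-- The coefficient of `u^{-r} v^{-s}` is a combination of words of weight at most `r + s - k`. -/
def SeriesFilt (k : ℕ) (f : B⟦X⟧⟦X⟧) : Prop :=
  ∀ r s, PowerSeries.coeff s (PowerSeries.coeff r f) ∈ filt b wt (r + s + 1 - k)

variable {b wt}

lemma SeriesFilt.add {k : ℕ} {f g : B⟦X⟧⟦X⟧} (hf : SeriesFilt b wt k f)
    (hg : SeriesFilt b wt k g) : SeriesFilt b wt k (f + g) := fun r s => by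
  simpa using add_mem (hf r s) (hg r s)

lemma SeriesFilt.sub {k : ℕ} {f g : B⟦X⟧⟦X⟧} (hf : SeriesFilt b wt k f)
    (hg : SeriesFilt b wt k g) : SeriesFilt b wt k (f - g) := fun r s => by
  simpa using sub_mem (hf r s) (hg r s)

lemma SeriesFilt.sum {κ : Type*} {t : Finset κ} {k : ℕ} {f : κ → B⟦X⟧⟦X⟧}
    (hf : ∀ i ∈ t, SeriesFilt b wt k (f i)) : SeriesFilt b wt k (∑ i ∈ t, f i) := fun r s => by
  rw [map_sum, map_sum]
  exact sum_mem fun i hi => hf i hi r s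

lemma SeriesFilt.mono {k k' : ℕ} {f : B⟦X⟧⟦X⟧} (hf : SeriesFilt b wt k f) (h : k' ≤ k) :
    SeriesFilt b wt k' f := fun r s => filt_mono (by omega) (hf r s)

lemma SeriesFilt.mul {f g : B⟦X⟧⟦X⟧} (hf : SeriesFilt b wt 0 f) (hg : SeriesFilt b wt 0 g) :
    SeriesFilt b wt 0 (f * g) := fun r s => by
  rw [PowerSeries.coeff_mul, map_sum]
  refine sum_mem fun x hx => ?_
  rw [PowerSeries.coeff_mul]
  refine sum_mem fun y hy => mul_mem_filt (hf _ _) (hg _ _) ?_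
  have := Finset.HasAntidiagonal.mem_antidiagonal.1 hx
  have := Finset.HasAntidiagonal.mem_antidiagonal.1 hy
  omega

lemma SeriesFilt.uInv_mul {k : ℕ} {f : B⟦X⟧⟦X⟧} (hf : SeriesFilt b wt k f) :
    SeriesFilt b wt (k + 1) (uInv * f) := fun r s => by
  rcases r with _ | r
  · rw [coeff_zero_uInv_mul, map_zero]
    exact zero_mem _
  · rw [coeff_coeff_uInv_mul]
    exact filt_mono (by omega) (hf r s)

lemma SeriesFilt.vInv_mul {k : ℕ} {f : B⟦X⟧⟦X⟧} (hf : SeriesFilt b wt k f) :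
    SeriesFilt b wt (k + 1) (vInv * f) := fun r s => by
  rcases s with _ | s
  · rw [coeff_zero_coeff_vInv_mul]
    exact zero_mem _
  · rw [coeff_coeff_vInv_mul]
    exact filt_mono (by omega) (hf r s)

/-- This is the shape of the right side in `reflection_commutator`. Every term carries at least
three factors `u⁻¹` or `v⁻¹`, and each of them lowers the weight by one relative to the order of the
coefficient. -/
lemma seriesFilt_three {f g h : B⟦X⟧⟦X⟧} (hf : SeriesFilt b wt 0 f) (hg : SeriesFilt b wt 0 g)
    (hh : SeriesFilt b wt 0 h) :
    SeriesFilt b wt 3 (uInv * (vInv * (vInv * f - uInv * f + vInv * g + uInv * g)) +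
      uInv * (vInv * (uInv * (vInv * h)))) :=
  ((((hf.vInv_mul.sub hf.uInv_mul).add hg.vInv_mul).add hg.uInv_mul).vInv_mul.uInv_mul).add
    (hh.vInv_mul.uInv_mul.vInv_mul.uInv_mul.mono (by omega))

/-- Division by `v⁻² - u⁻²`: the coefficient of `u^{-r} v^{-(s+2)}` is `f_{r,s} - f_{r-2,s+2}`, with
`r + s` the same in both terms. The recursion ends at `r = 0`, where `f` vanishes, or at `r = 1`,
where the second term is absent. -/
lemma coeff_mem_filt_of_seriesFilt {f : B⟦X⟧⟦X⟧} (hf : PowerSeries.coeff 0 f = 0)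
    (h : SeriesFilt b wt 3 (vInv * (vInv * f) - uInv * (uInv * f))) (r s : ℕ) :
    PowerSeries.coeff s (PowerSeries.coeff r f) ∈ filt b wt (r + s) := by
  induction r using Nat.twoStepInduction generalizing s with
  | zero => simp [hf]
  | one =>
    have := h 1 (s + 2)
    rw [map_sub, map_sub, coeff_coeff_vInv_mul, coeff_coeff_vInv_mul,
      show 1 = 0 + 1 from rfl, coeff_coeff_uInv_mul, coeff_zero_uInv_mul, map_zero,
      sub_zero] at this
    exact filt_mono (by omega) this
  | more r ih _ =>
    have := h (r + 2) (s + 2)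
    rw [map_sub, map_sub, coeff_coeff_vInv_mul, coeff_coeff_vInv_mul,
      coeff_coeff_uInv_mul, coeff_coeff_uInv_mul] at this
    have h2 := add_mem this (filt_mono (show r + (s + 2) ≤ r + 2 + (s + 2) + 1 - 3 by omega)
      (ih (s + 2)))
    rw [sub_add_cancel] at h2
    exact filt_mono (by omega) h2

lemma coeff_negArg_mem_filt {f : B⟦X⟧} {s d : ℕ} (hf : PowerSeries.coeff s f ∈ filt b wt d) :
    PowerSeries.coeff s (negArg f) ∈ filt b wt d := by
  rw [coeff_negArg]
  rcases Nat.even_or_odd s with h | h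
  · rwa [h.neg_one_pow, one_mul]
  · rw [h.neg_one_pow, neg_one_mul]
    exact neg_mem hf

lemma coeff_succ_mul_sub_mem_filt {f g : B⟦X⟧} {r : ℕ}
    (hf : ∀ s ≤ r, PowerSeries.coeff s f ∈ filt b wt (s + 1))
    (hg : ∀ s ≤ r, PowerSeries.coeff s g ∈ filt b wt (s + 1)) :
    PowerSeries.coeff (r + 1) (f * g) -
      (PowerSeries.coeff 0 f * PowerSeries.coeff (r + 1) g +
        PowerSeries.coeff (r + 1) f * PowerSeries.coeff 0 g) ∈ filt b wt (r + 2) := by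
  rw [PowerSeries.coeff_mul, Finset.Nat.sum_antidiagonal_eq_sum_range_succ_mk,
    Finset.sum_range_succ, Finset.sum_range_succ', Nat.sub_zero, Nat.sub_self, add_assoc,
    add_sub_cancel_right]
  refine sum_mem fun k hk => ?_
  rw [Finset.mem_range] at hk
  exact mul_mem_filt (hf _ (by omega)) (hg _ (by omega)) (by omega)

variable {n : ℕ}

lemma seriesFilt_inU {f : B⟦X⟧} (hf : ∀ r, PowerSeries.coeff r f ∈ filt b wt (r + 1)) :
    SeriesFilt b wt 0 (inU f) := fun r s => by
  rw [inU, PowerSeries.coeff_map, PowerSeries.coeff_C]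
  split_ifs with h
  · exact filt_mono (by omega) (hf r)
  · exact zero_mem _

lemma seriesFilt_inV {f : B⟦X⟧} (hf : ∀ r, PowerSeries.coeff r f ∈ filt b wt (r + 1)) :
    SeriesFilt b wt 0 (inV f) := fun r s => by
  rw [inV, PowerSeries.coeff_C]
  split_ifs with h
  · exact filt_mono (by omega) (hf s)
  · simp

/-- The part free of `P` is `(y² - x²)(B₁ B₂ - B₂ B₁)`; all other terms contain the factor `x y` and
go to the right. -/
lemma reflection_commutator_aux {K R : Type*} [CommRing K] [Ring R] [Algebra K R] (x y : K)
    {P B₁ B₂ : R}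
    (h : ((y - x) • 1 - (x * y) • P) * B₁ * ((y + x) • 1 - (x * y) • P) * B₂ =
      B₂ * ((y + x) • 1 - (x * y) • P) * B₁ * ((y - x) • 1 - (x * y) • P)) :
    y • y • (B₁ * B₂ - B₂ * B₁) - x • x • (B₁ * B₂ - B₂ * B₁) =
      x • y • (y • (B₁ * (P * B₂) - B₂ * (P * B₁)) - x • (B₁ * (P * B₂) - B₂ * (P * B₁)) +
        y • (P * (B₁ * B₂) - B₂ * (B₁ * P)) + x • (P * (B₁ * B₂) - B₂ * (B₁ * P))) +
      x • y • x • y • (B₂ * (P * (B₁ * P)) - P * (B₁ * (P * B₂))) := by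
  rw [← sub_eq_zero] at h ⊢
  rw [← h]
  simp only [sub_mul, mul_sub, smul_mul_assoc, mul_smul_comm, mul_assoc, one_mul, mul_one]
  module

/-- The reflection equation, solved for the commutators of the matrix entries. -/
lemma reflection_commutator {B : Type*} [Ring B] {M : Matrix (Fin n) (Fin n) B⟦X⟧}
    (h : reflectionLHS M = reflectionRHS M) (i j k m : Fin n) :
    vInv * (vInv * (inU (M i j) * inV (M k m) - inV (M k m) * inU (M i j))) -
        uInv * (uInv * (inU (M i j) * inV (M k m) - inV (M k m) * inU (M i j))) =
      uInv * (vInv * (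
          vInv * ((firstU M * (permP n B⟦X⟧⟦X⟧ * secondV M)) (i, k) (j, m) -
            (secondV M * (permP n B⟦X⟧⟦X⟧ * firstU M)) (i, k) (j, m)) -
          uInv * ((firstU M * (permP n B⟦X⟧⟦X⟧ * secondV M)) (i, k) (j, m) -
            (secondV M * (permP n B⟦X⟧⟦X⟧ * firstU M)) (i, k) (j, m)) +
          vInv * ((permP n B⟦X⟧⟦X⟧ * (firstU M * secondV M)) (i, k) (j, m) -
            (secondV M * (firstU M * permP n B⟦X⟧⟦X⟧)) (i, k) (j, m)) +
          uInv * ((permP n B⟦X⟧⟦X⟧ * (firstU M * secondV M)) (i, k) (j, m) -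
            (secondV M * (firstU M * permP n B⟦X⟧⟦X⟧)) (i, k) (j, m)))) +
        uInv * (vInv * (uInv * (vInv * (
          (secondV M * (permP n B⟦X⟧⟦X⟧ * (firstU M * permP n B⟦X⟧⟦X⟧))) (i, k) (j, m) -
            (permP n B⟦X⟧⟦X⟧ * (firstU M * (permP n B⟦X⟧⟦X⟧ * secondV M))) (i, k) (j, m))))) := by
  rw [reflectionLHS, reflectionRHS, rMinus_eq, rPlus_eq] at h
  have key := congrArg (fun N => N (i, k) (j, m)) (reflection_commutator_aux _ _ h)
  rw [← firstU_mul_secondV_apply M M (i, k) (j, m), ← secondV_mul_firstU_apply M M (i, k) (j, m)]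
  exact key

lemma commutator_mem_filt_of_reflection {M : Matrix (Fin n) (Fin n) B⟦X⟧}
    (hM : ∀ i j r, PowerSeries.coeff r (M i j) ∈ filt b wt (r + 1))
    (h0 : ∀ i j, ∃ c : ℂ, PowerSeries.coeff 0 (M i j) = algebraMap ℂ B c)
    (h : reflectionLHS M = reflectionRHS M) (i j k m : Fin n) (r s : ℕ) :
    PowerSeries.coeff r (M i j) * PowerSeries.coeff s (M k m) -
      PowerSeries.coeff s (M k m) * PowerSeries.coeff r (M i j) ∈ filt b wt (r + s) := by
  have hmul {N N' : Matrix (Fin n × Fin n) (Fin n × Fin n) B⟦X⟧⟦X⟧}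
      (hN : ∀ p q, SeriesFilt b wt 0 (N p q)) (hN' : ∀ p q, SeriesFilt b wt 0 (N' p q)) :
      ∀ p q, SeriesFilt b wt 0 ((N * N') p q) := fun p q => by
    rw [Matrix.mul_apply]
    exact SeriesFilt.sum fun x _ => (hN _ _).mul (hN' _ _)
  have hz : SeriesFilt b wt 0 0 := fun r s => by simp
  have h1 : ∀ p q, SeriesFilt b wt 0 (firstU M p q) := fun p q => by
    rw [firstU_apply]
    split_ifs
    exacts [seriesFilt_inU (hM _ _), hz]
  have h2 : ∀ p q, SeriesFilt b wt 0 (secondV M p q) := fun p q => by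
    rw [secondV_apply]
    split_ifs
    exacts [seriesFilt_inV (hM _ _), hz]
  have hP : ∀ p q, SeriesFilt b wt 0 (permP n B⟦X⟧⟦X⟧ p q) := fun p q => by
    rw [permP, Matrix.of_apply]
    split_ifs
    · rw [← map_one inU]
      refine seriesFilt_inU fun r => ?_
      rw [PowerSeries.coeff_one]
      split_ifs
      exacts [one_mem_filt (by omega), zero_mem _]
    · exact hz
  have hD : SeriesFilt b wt 3
      (vInv * (vInv * (inU (M i j) * inV (M k m) - inV (M k m) * inU (M i j))) -
        uInv * (uInv * (inU (M i j) * inV (M k m) - inV (M k m) * inU (M i j)))) := by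
    rw [reflection_commutator h]
    have w1 := (hmul h1 (hmul hP h2) (i, k) (j, m)).sub (hmul h2 (hmul hP h1) (i, k) (j, m))
    have w2 := (hmul hP (hmul h1 h2) (i, k) (j, m)).sub (hmul h2 (hmul h1 hP) (i, k) (j, m))
    have w3 := (hmul h2 (hmul hP (hmul h1 hP)) (i, k) (j, m)).sub
      (hmul hP (hmul h1 (hmul hP h2)) (i, k) (j, m))
    exact seriesFilt_three w1 w2 w3
  have := coeff_mem_filt_of_seriesFilt ?_ hD r s
  · rwa [map_sub, map_sub, coeff_coeff_inU_mul_inV, coeff_coeff_inV_mul_inU] at this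
  -- The order-zero coefficient of `M i j` is scalar, so its commutators vanish; this starts the
  -- recursion in `r`.
  · ext t
    obtain ⟨c, hc⟩ := h0 i j
    rw [map_sub, map_sub, coeff_coeff_inU_mul_inV, coeff_coeff_inV_mul_inU, hc,
      Algebra.commutes, sub_self, map_zero]

end FilteredSeries

/-! ### Generators left free by the unitary condition -/

section ReflectionGenerators

variable (n l : ℕ)

/-- The signs `ε_i`. -/
def sign (i : Fin n) : ℂ := if (i : ℕ) + l < n then 1 else -1

/-- The indices of a set of generators of the reflection algebra on which the unitary condition
imposes no linear constraint. -/
abbrev FreeIndex : Type :=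
  {g : GenIndex n // sign n l g.2.1 = (-1) ^ g.2.2 * sign n l g.1}

/-- The generators indexed by `FreeIndex`. -/
def freeGen (g : FreeIndex n l) : ReflAlg n l :=
  PowerSeries.coeff (g.1.2.2 + 1) (matB n l g.1.1 g.1.2.1)

/-- The weight of `b_ij^{(r)}` is `r`. -/
def genWt (g : FreeIndex n l) : ℕ := g.1.2.2 + 1

variable {n l}

lemma coeff_zero_matB (i j : Fin n) :
    PowerSeries.coeff 0 (matB n l i j) =
      algebraMap ℂ (ReflAlg n l) (if i = j then sign n l i else 0) := by
  rw [PowerSeries.coeff_zero_eq_constantCoeff_apply]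
  have := congrFun (congrFun (constantCoeff_matB n l) i) j
  rw [Matrix.map_apply] at this
  rw [this, matG, Matrix.diagonal_apply, sign]
  split_ifs <;> simp

lemma sign_mul_sign (i : Fin n) : sign n l i * sign n l i = 1 := by
  rw [sign]
  split_ifs <;> norm_num

/-- At order `r + 1` the unitary condition reads `(ε_j + (-1)^{r+1} ε_i) b_ij^{(r+1)} + (products of
lower coefficients) = 0` or a similar identity with right side zero. Outside `FreeIndex` the scalar
is `2 ε_j`, so the generator is expressed by lower ones. -/
lemma coeff_matB_mem_filt (r : ℕ) (i j : Fin n) :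
    PowerSeries.coeff r (matB n l i j) ∈ filt (freeGen n l) (genWt n l) (r + 1) := by
  induction r using Nat.strong_induction_on generalizing i j with
  | _ r ih =>
    rcases r with _ | r
    · rw [coeff_zero_matB, Algebra.algebraMap_eq_smul_one]
      exact Submodule.smul_mem _ _ (one_mem_filt (by omega))
    by_cases hg : sign n l j = (-1) ^ r * sign n l i
    · exact basic_mem_filt (b := freeGen n l) (wt := genWt n l) ⟨(i, j, r), hg⟩
    have hs : sign n l j = -((-1) ^ r * sign n l i) := by
      revert hg
      rw [sign, sign]
      rcases Nat.even_or_odd r with h | h <;> rw [h.neg_one_pow] <;> split_ifs <;> norm_num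
    have h1 := congrArg (PowerSeries.coeff (r + 1)) (congrFun (congrFun (unitary_matB n l) i) j)
    rw [Matrix.mul_apply, map_sum] at h1
    have h2 (k : Fin n) : PowerSeries.coeff (r + 1) (matB n l i k * negArg (matB n l k j)) -
        (PowerSeries.coeff 0 (matB n l i k) *
            ((-1) ^ (r + 1) * PowerSeries.coeff (r + 1) (matB n l k j)) +
          PowerSeries.coeff (r + 1) (matB n l i k) * PowerSeries.coeff 0 (matB n l k j)) ∈
        filt (freeGen n l) (genWt n l) (r + 2) := by
      have := coeff_succ_mul_sub_mem_filt (b := freeGen n l) (wt := genWt n l) (r := r)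
        (f := matB n l i k) (g := negArg (matB n l k j)) (fun s hs => ih s (by omega) _ _)
        (fun s hs => coeff_negArg_mem_filt (ih s (by omega) k j))
      simpa using this
    have h3 := sum_mem (t := Finset.univ) fun k _ => h2 k
    rw [Finset.sum_sub_distrib, Finset.sum_add_distrib] at h3
    simp only [Matrix.map_apply] at h1
    have h4 : PowerSeries.coeff (r + 1) ((1 : Matrix _ _ (ReflAlg n l)⟦X⟧) i j) = 0 := by
      rw [Matrix.one_apply]
      split_ifs <;> simp [PowerSeries.coeff_one]
    rw [h1, h4, zero_sub, neg_mem_iff, Finset.sum_eq_single i, Finset.sum_eq_single j,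
      coeff_zero_matB, coeff_zero_matB, if_pos rfl, if_pos rfl, ← Algebra.commutes,
      ← Algebra.smul_def, ← Algebra.smul_def] at h3
    -- The factor `ε_j / 2` is the inverse of `2 ε_j`.
    · have h5 : PowerSeries.coeff (r + 1) (matB n l i j) = (sign n l j / 2) •
          (sign n l i • ((-1) ^ (r + 1) * PowerSeries.coeff (r + 1) (matB n l i j)) +
            sign n l j • PowerSeries.coeff (r + 1) (matB n l i j)) := by
        have h6 : (-1) ^ (r + 1) * PowerSeries.coeff (r + 1) (matB n l i j) =
            ((-1 : ℂ) ^ (r + 1)) • PowerSeries.coeff (r + 1) (matB n l i j) := by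
          rw [Algebra.smul_def]
          simp
        have h7 : sign n l i * (-1) ^ (r + 1) = sign n l j := by
          rw [hs]
          ring
        have h8 : sign n l j / 2 * (sign n l j + sign n l j) = 1 := by
          rw [← sign_mul_sign (n := n) (l := l) j]
          ring
        rw [h6, smul_smul, h7, ← add_smul, smul_smul, h8, one_smul]
      rw [h5]
      exact Submodule.smul_mem _ _ h3
    · rintro k - hk
      rw [coeff_zero_matB, if_neg hk, map_zero, mul_zero]
    · simp
    · rintro k - hk
      rw [coeff_zero_matB, if_neg hk.symm, map_zero, zero_mul]
    · simp

lemma commutator_freeGen (g h : FreeIndex n l) :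
    freeGen n l g * freeGen n l h - freeGen n l h * freeGen n l g ∈
      filt (freeGen n l) (genWt n l) (genWt n l g + genWt n l h) :=
  commutator_mem_filt_of_reflection (fun i j r => coeff_matB_mem_filt r i j)
    (fun i j => ⟨_, coeff_zero_matB i j⟩) (reflection_matB n l) _ _ _ _ _ _

lemma exists_mem_filt (z : ReflAlg n l) : ∃ d, z ∈ filt (freeGen n l) (genWt n l) d := by
  obtain ⟨a, rfl⟩ := RingQuot.mkAlgHom_surjective ℂ (ReflectionRel n l) z
  induction a using FreeAlgebra.induction with
  | grade0 c =>
    refine ⟨1, ?_⟩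
    rw [AlgHom.commutes, Algebra.algebraMap_eq_smul_one]
    exact Submodule.smul_mem _ _ (one_mem_filt (by omega))
  | grade1 g =>
    obtain ⟨i, j, r⟩ := g
    refine ⟨r + 1 + 1, ?_⟩
    convert coeff_matB_mem_filt (r + 1) i j
    simp only [matB, Matrix.map_apply, coeff_map_toRingHom, freeB, genericMatrix, Matrix.of_apply,
      PowerSeries.coeff_mk]
  | mul a b ha hb =>
    obtain ⟨d, hd⟩ := ha
    obtain ⟨e, he⟩ := hb
    exact ⟨d + e, by rw [map_mul]; exact mul_mem_filt hd he (by omega)⟩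
  | add a b ha hb =>
    obtain ⟨d, hd⟩ := ha
    obtain ⟨e, he⟩ := hb
    refine ⟨d + e, ?_⟩
    rw [map_add]
    exact add_mem (filt_mono (by omega) hd) (filt_mono (by omega) he)

end ReflectionGenerators

/-! ### Products of rank-one factors realise arbitrary symbols -/

section DenseFactorization

variable {n : ℕ}

/-- The factors `1 + x yᵀ u⁻¹` with `x yᵀ` a matrix of rank at most one. -/
def rankOneFactor (x y : Fin n → ℂ) : (Matrix (Fin n) (Fin n) ℂ)⟦X⟧ :=
  1 + PowerSeries.C (Matrix.vecMulVec x y) * PowerSeries.X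

variable (n) in
/-- The products of factors `1 + x yᵀ u⁻¹`. -/
def rankOneProducts : Submonoid (Matrix (Fin n) (Fin n) ℂ)⟦X⟧ :=
  Submonoid.closure {p | ∃ x y, p = rankOneFactor x y}

/-- The block sum of `p(u⁻¹)` on the image of an idempotent `E` and `1` on its kernel. -/
def idempotentSeries (E : Matrix (Fin n) (Fin n) ℂ) (p : Polynomial ℂ) :
    (Matrix (Fin n) (Fin n) ℂ)⟦X⟧ :=
  (1 - PowerSeries.C E) +
    PowerSeries.C E * PowerSeries.map (algebraMap ℂ (Matrix (Fin n) (Fin n) ℂ)) (p : ℂ⟦X⟧)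

lemma idempotentSeries_mul {E : Matrix (Fin n) (Fin n) ℂ} (hE : E * E = E) (p q : Polynomial ℂ) :
    idempotentSeries E (p * q) = idempotentSeries E p * idempotentSeries E q := by
  have hc : Commute (PowerSeries.C E) (PowerSeries.map (algebraMap ℂ (Matrix (Fin n) (Fin n) ℂ))
      (p : ℂ⟦X⟧)) := by
    ext1 r
    rw [PowerSeries.coeff_C_mul, PowerSeries.coeff_mul_C, PowerSeries.coeff_map]
    exact (Algebra.commutes _ _).symm
  have hC : (PowerSeries.C E : (Matrix (Fin n) (Fin n) ℂ)⟦X⟧) * PowerSeries.C E =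
      PowerSeries.C E := by
    rw [← map_mul, hE]
  simp only [idempotentSeries, Polynomial.coe_mul, map_mul]
  generalize PowerSeries.map (algebraMap ℂ (Matrix (Fin n) (Fin n) ℂ)) (p : ℂ⟦X⟧) = P at *
  generalize PowerSeries.map (algebraMap ℂ (Matrix (Fin n) (Fin n) ℂ)) (q : ℂ⟦X⟧) = Q at *
  generalize (PowerSeries.C E : (Matrix (Fin n) (Fin n) ℂ)⟦X⟧) = e at *
  have h1 : e * P * (e * Q) = e * (P * Q) := by
    rw [hc.eq, mul_assoc, ← mul_assoc e, hC, ← mul_assoc, ← hc.eq, mul_assoc]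
  have h2 : (1 - e) * (e * Q) = 0 := by rw [sub_mul, one_mul, ← mul_assoc, hC, sub_self]
  have h3 : e * P * (1 - e) = 0 := by
    rw [hc.eq, mul_sub, mul_one, mul_assoc, hC, sub_self]
  have h4 : (1 - e) * (1 - e) = 1 - e := by
    rw [sub_mul, mul_sub, mul_sub, hC]
    simp
  rw [add_mul, mul_add, mul_add, h1, h2, h3, h4, add_zero, zero_add]

/-- Over `ℂ` a polynomial with constant term `1` splits into factors `1 - α⁻¹ X`. By
multiplicativity in `p`, each of them contributes one factor `1 - α⁻¹ x yᵀ u⁻¹`. -/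
lemma idempotentSeries_mem {x y : Fin n → ℂ}
    (hE : Matrix.vecMulVec x y * Matrix.vecMulVec x y = Matrix.vecMulVec x y) (d : ℕ) :
    ∀ p : Polynomial ℂ, p.natDegree ≤ d → p.coeff 0 = 1 →
      idempotentSeries (Matrix.vecMulVec x y) p ∈ rankOneProducts n := by
  have hone : idempotentSeries (Matrix.vecMulVec x y) 1 = 1 := by simp [idempotentSeries]
  induction d with
  | zero =>
    intro p hp h0
    rw [Polynomial.eq_C_of_natDegree_le_zero hp, h0, map_one, hone]
    exact one_mem _
  | succ d ih =>
    intro p hp h0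
    by_cases hd : p.natDegree = 0
    · exact ih p (by omega) h0
    obtain ⟨α, hα⟩ := IsAlgClosed.exists_root p fun h =>
      hd (Polynomial.natDegree_eq_of_degree_eq_some h)
    obtain ⟨q, rfl⟩ := Polynomial.dvd_iff_isRoot.2 hα
    have hα0 : α ≠ 0 := by
      rintro rfl
      simp at h0
    have hq : (Polynomial.X - Polynomial.C α) * q =
        (1 - Polynomial.C α⁻¹ * Polynomial.X) * (Polynomial.C (-α) * q) := by
      rw [← mul_assoc]
      congr 1
      have : Polynomial.C α⁻¹ * Polynomial.C α = 1 := by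
        rw [← map_mul, inv_mul_cancel₀ hα0, map_one]
      rw [map_neg]
      linear_combination -Polynomial.X * this
    have hq0 : q ≠ 0 := by
      rintro rfl
      simp at h0
    rw [Polynomial.natDegree_mul (Polynomial.X_sub_C_ne_zero α) hq0,
      Polynomial.natDegree_X_sub_C] at hp
    rw [hq, idempotentSeries_mul hE]
    refine mul_mem (Submonoid.subset_closure ⟨-α⁻¹ • x, y, ?_⟩) (ih _ ?_ ?_)
    · rw [idempotentSeries, rankOneFactor, Matrix.smul_vecMulVec]
      ext1 r
      rcases r with _ | _ | r <;>
        simp [PowerSeries.coeff_one, Algebra.algebraMap_eq_smul_one]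
    · exact (Polynomial.natDegree_C_mul_le _ _).trans (by omega)
    · simpa using h0

/-- The leading corrections `c` reached by such products are closed under addition, since
multiplying `1 + X^m h` and `1 + X^m h'` adds leading terms. Taking `p = 1 + a X^m` reaches all
multiples of rank-one idempotents, and these span all matrices. -/
lemma exists_one_add_X_pow_mul_mem {m : ℕ} (hm : 0 < m) (c : Matrix (Fin n) (Fin n) ℂ) :
    ∃ h : (Matrix (Fin n) (Fin n) ℂ)⟦X⟧, PowerSeries.constantCoeff h = c ∧
      1 + PowerSeries.X ^ m * h ∈ rankOneProducts n := by
  let W : AddSubmonoid (Matrix (Fin n) (Fin n) ℂ) :=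
    { carrier := {c | ∃ h : (Matrix (Fin n) (Fin n) ℂ)⟦X⟧, PowerSeries.constantCoeff h = c ∧
        1 + PowerSeries.X ^ m * h ∈ rankOneProducts n}
      zero_mem' := ⟨0, map_zero _, by rw [mul_zero, add_zero]; exact one_mem _⟩
      add_mem' := by
        rintro _ _ ⟨h, rfl, hh⟩ ⟨h', rfl, hh'⟩
        refine ⟨h + h' + PowerSeries.X ^ m * h * h', ?_, ?_⟩
        · simp [hm.ne']
        · convert mul_mem hh hh' using 1
          simp only [mul_add, add_mul, mul_one, one_mul, mul_assoc,
            (PowerSeries.commute_X_pow h m).left_comm]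
          abel }
  have hW {x y : Fin n → ℂ}
      (hE : Matrix.vecMulVec x y * Matrix.vecMulVec x y = Matrix.vecMulVec x y) (a : ℂ) :
      a • Matrix.vecMulVec x y ∈ W := by
    refine ⟨PowerSeries.C (a • Matrix.vecMulVec x y), by simp, ?_⟩
    convert idempotentSeries_mem hE _ (1 + Polynomial.C a * Polynomial.X ^ m) le_rfl
      (by simp [hm.ne]) using 1
    rw [idempotentSeries]
    ext1 r
    rcases r with _ | r
    · simp [hm.ne']
    · simp [PowerSeries.coeff_X_pow, Algebra.algebraMap_eq_smul_one]
  suffices c ∈ W from this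
  rw [Matrix.matrix_eq_sum_single c]
  refine sum_mem fun i _ => sum_mem fun j _ => ?_
  have h1 (a : ℂ) : Matrix.single i i a ∈ W := by
    convert hW (x := Pi.single i 1) (y := Pi.single i 1) ?_ a using 1
    · rw [← Matrix.single_eq_single_vecMulVec_single, Matrix.smul_single, smul_eq_mul, mul_one]
    · rw [Matrix.vecMulVec_mul_vecMulVec]
      simp
  by_cases hij : i = j
  · subst hij
    exact h1 _
  -- `E_ij = (E_ii + E_ij) - E_ii`, a difference of two rank-one idempotents.
  · have h2 := add_mem (hW (x := Pi.single i 1) (y := Pi.single i 1 + Pi.single j 1) ?_ (c i j))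
      (h1 (-c i j))
    · rw [Matrix.vecMulVec_add, ← Matrix.single_eq_single_vecMulVec_single,
        ← Matrix.single_eq_single_vecMulVec_single, smul_add, Matrix.smul_single,
        Matrix.smul_single, smul_eq_mul, mul_one, add_right_comm, ← Matrix.single_add,
        add_neg_cancel, Matrix.single_zero, zero_add] at h2
      exact h2
    · rw [Matrix.vecMulVec_mul_vecMulVec]
      simp [hij]

lemma constantCoeff_rankOneProducts {p : (Matrix (Fin n) (Fin n) ℂ)⟦X⟧}
    (hp : p ∈ rankOneProducts n) : PowerSeries.constantCoeff p = 1 := by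
  induction hp using Submonoid.closure_induction with
  | mem p hp =>
    obtain ⟨x, y, rfl⟩ := hp
    simp [rankOneFactor]
  | one => exact map_one _
  | mul p q _ _ hp hq => rw [map_mul, hp, hq, one_mul]

/-- The symbols of the generators `b_ij^{(r)}`, `r ≤ d`, indexed by `FreeIndex` can be prescribed
arbitrarily. -/
lemma exists_rankOneProducts_coeff_eq (l : ℕ) (τ : FreeIndex n l → ℂ) (d : ℕ) :
    ∃ q q' : (Matrix (Fin n) (Fin n) ℂ)⟦X⟧, q ∈ rankOneProducts n ∧ q * q' = 1 ∧
      ∀ g : FreeIndex n l, genWt n l g ≤ d →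
        PowerSeries.coeff (g.1.2.2 + 1) (q * PowerSeries.C (matG n l ℂ) * negArg q')
          g.1.1 g.1.2.1 = τ g := by
  induction d with
  | zero => exact ⟨1, 1, one_mem _, one_mul 1, fun g hg => by simp [genWt] at hg⟩
  | succ d ih =>
    classical
    obtain ⟨q, q', hq, hqq, hτ⟩ := ih
    set β := q * PowerSeries.C (matG n l ℂ) * negArg q' with hβ
    have hβ0 : PowerSeries.constantCoeff β = matG n l ℂ := by
      have h1 := constantCoeff_rankOneProducts hq
      have h2 := congrArg PowerSeries.constantCoeff hqq
      rw [map_mul, h1, one_mul, map_one] at h2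
      rw [hβ, map_mul, map_mul, constantCoeff_negArg, h1, h2, one_mul, mul_one,
        PowerSeries.constantCoeff_C]
    -- Left multiplication of `q` by `1 + c X^{d+1} + ⋯` keeps the coefficients of `β` up to order
    -- `d` and adds `c G + (-1)^d G c` at order `d + 1`. On `FreeIndex` the `(i, j)` entry of this
    -- is `2 ε_j c_ij`, which determines `c`.
    set c : Matrix (Fin n) (Fin n) ℂ := Matrix.of fun i j =>
      sign n l j * ((if h : sign n l j = (-1) ^ d * sign n l i then τ ⟨(i, j, d), h⟩ else 0) -
        PowerSeries.coeff (d + 1) β i j) / 2 with hc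
    obtain ⟨h, h0, hh⟩ := exists_one_add_X_pow_mul_mem (Nat.succ_pos d) c
    obtain ⟨k, hk⟩ : ∃ k, (1 + PowerSeries.X ^ (d + 1) * h) * k = 1 :=
      ⟨_, PowerSeries.mul_invOfUnit _ 1 (by simp)⟩
    have hk' : k = 1 - PowerSeries.X ^ (d + 1) * (h * k) := by
      rw [add_mul, one_mul, mul_assoc] at hk
      rw [← hk, add_sub_cancel_right]
    have hk0 : PowerSeries.constantCoeff k = 1 := by
      rw [hk']; simp
    have hX : negArg (PowerSeries.X ^ (d + 1) : (Matrix (Fin n) (Fin n) ℂ)⟦X⟧) =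
        (-1) ^ (d + 1) * PowerSeries.X ^ (d + 1) := by
      rw [← negHom_apply, map_pow, negHom_apply, negArg_X, neg_pow]
    set h' : (Matrix (Fin n) (Fin n) ℂ)⟦X⟧ := -(-1) ^ (d + 1) * negArg (h * k) with hh'
    have hnk : negArg k = 1 + PowerSeries.X ^ (d + 1) * h' := by
      conv_lhs => rw [hk']
      rw [← negHom_apply, map_sub, map_one, map_mul, negHom_apply, negHom_apply, hX, hh',
        mul_assoc, neg_mul, mul_neg, sub_eq_add_neg,
        ((Commute.neg_one_right (PowerSeries.X ^ (d + 1))).pow_right (d + 1)).left_comm]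
    refine ⟨(1 + PowerSeries.X ^ (d + 1) * h) * q, q' * k, mul_mem hh hq, ?_, fun g hg => ?_⟩
    · calc _ = (1 + PowerSeries.X ^ (d + 1) * h) * (q * q') * k := by simp only [mul_assoc]
        _ = 1 := by rw [hqq, mul_one, hk]
    have e : (1 + PowerSeries.X ^ (d + 1) * h) * q * PowerSeries.C (matG n l ℂ) *
        negArg (q' * k) = β + PowerSeries.X ^ (d + 1) *
          (h * β + β * h' + PowerSeries.X ^ (d + 1) * (h * β * h')) := by
      have e1 : (1 + PowerSeries.X ^ (d + 1) * h) * q * PowerSeries.C (matG n l ℂ) *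
          negArg (q' * k) = (1 + PowerSeries.X ^ (d + 1) * h) * β *
            (1 + PowerSeries.X ^ (d + 1) * h') := by
        rw [negArg_mul, ← hnk, hβ]
        simp only [mul_assoc]
      rw [e1]
      simp only [mul_add, add_mul, mul_one, one_mul, mul_assoc,
        (PowerSeries.commute_X_pow h (d + 1)).left_comm,
        (PowerSeries.commute_X_pow β (d + 1)).left_comm]
      abel
    rw [e]
    obtain ⟨⟨i, j, r⟩, hg'⟩ := g
    simp only [genWt] at hg hg' ⊢
    rcases (show r ≤ d by omega).lt_or_eq with hr | rfl
    · rw [map_add, PowerSeries.coeff_X_pow_mul', if_neg (by omega), add_zero]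
      exact hτ ⟨(i, j, r), hg'⟩ hr
    · have h'0 : PowerSeries.constantCoeff h' = -(-1) ^ (r + 1) * c := by
        rw [hh', map_mul, constantCoeff_negArg, map_mul, h0, hk0, mul_one, map_neg, map_pow,
          map_neg, map_one]
      have h1 : PowerSeries.constantCoeff
          (h * β + β * h' + PowerSeries.X ^ (r + 1) * (h * β * h')) =
          c * matG n l ℂ + matG n l ℂ * (-(-1) ^ (r + 1) * c) := by
        rw [map_add, map_add, map_mul _ h β, map_mul _ β h', map_mul _ (PowerSeries.X ^ (r + 1)) _,
          map_pow, PowerSeries.constantCoeff_X,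
          h'0, h0, hβ0, pow_succ (0 : Matrix _ _ ℂ), mul_zero, zero_mul, add_zero]
      rw [map_add, PowerSeries.coeff_X_pow_mul', if_pos le_rfl, Nat.sub_self,
        PowerSeries.coeff_zero_eq_constantCoeff_apply, h1]
      have hcij : c i j = sign n l j * (τ ⟨(i, j, r), hg'⟩ -
          PowerSeries.coeff (r + 1) β i j) / 2 := by
        rw [hc, Matrix.of_apply, dif_pos hg']
      have hG : matG n l ℂ = Matrix.diagonal (sign n l) := rfl
      have hs := sign_mul_sign (n := n) (l := l) j
      have hentry : (c * matG n l ℂ + matG n l ℂ * (-(-1) ^ (r + 1) * c)) i j =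
          2 * sign n l j * c i j := by
        rcases Nat.even_or_odd r with h | h
        · simp only [pow_succ, h.neg_one_pow, hG, Matrix.add_apply, Matrix.mul_diagonal,
            Matrix.diagonal_mul, mul_neg, mul_one, neg_neg, one_mul] at hg' ⊢
          rw [hg']
          ring
        · simp only [pow_succ, h.neg_one_pow, hG, Matrix.add_apply, Matrix.mul_diagonal,
            Matrix.diagonal_mul, mul_neg, mul_one, neg_neg, one_mul, neg_mul,
            Matrix.neg_apply] at hg' ⊢
          rw [hg']
          ring
      rw [Matrix.add_apply, hentry, hcij]
      linear_combination (τ ⟨(i, j, r), hg'⟩ - PowerSeries.coeff (r + 1) β i j) * hs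

end DenseFactorization

/-! ### Building solutions of RTT -/

section RTTConstructions

variable {A : Type*} [Ring A] {n : ℕ}

lemma commute_inU_inV {f g : A⟦X⟧}
    (h : ∀ r s, Commute (PowerSeries.coeff r f) (PowerSeries.coeff s g)) :
    inU f * inV g = inV g * inU f := by
  ext r s
  rw [coeff_coeff_inU_mul_inV, coeff_coeff_inV_mul_inU, (h r s).eq]

lemma firstU_mul_secondV_comm {M N : Matrix (Fin n) (Fin n) A⟦X⟧}
    (h : ∀ i j k m r s, Commute (PowerSeries.coeff r (M i j)) (PowerSeries.coeff s (N k m))) :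
    firstU M * secondV N = secondV N * firstU M := by
  ext1 p q
  rw [firstU_mul_secondV_apply, secondV_mul_firstU_apply, commute_inU_inV (h _ _ _ _)]

lemma isRTT_one : IsRTT (1 : Matrix (Fin n) (Fin n) A⟦X⟧) := by
  simp [IsRTT]

/-- The product of two solutions of the `RTT` relation with commuting entries is a solution. -/
lemma IsRTT.mul {M N : Matrix (Fin n) (Fin n) A⟦X⟧} (hM : IsRTT M) (hN : IsRTT N)
    (h : ∀ i j k m r s, Commute (PowerSeries.coeff r (M i j)) (PowerSeries.coeff s (N k m))) :
    IsRTT (M * N) := by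
  have h1 := firstU_mul_secondV_comm h
  have h2 := firstU_mul_secondV_comm fun i j k m r s => (h k m i j s r).symm
  rw [IsRTT] at *
  simp only [firstU_mul, secondV_mul]
  set R := rMinus n A
  calc R * (firstU M * firstU N * (secondV M * secondV N))
      = R * (firstU M * (firstU N * secondV M) * secondV N) := by simp only [mul_assoc]
    _ = (R * (firstU M * secondV M)) * (firstU N * secondV N) := by
        rw [h2]; simp only [mul_assoc]
    _ = secondV M * firstU M * (R * (firstU N * secondV N)) := by
        rw [hM]; simp only [mul_assoc]
    _ = secondV M * (firstU M * secondV N) * firstU N * R := by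
        rw [hN]; simp only [mul_assoc]
    _ = _ := by rw [h1]; simp only [mul_assoc]

/-- On the right the products `e₄ e₃` and the constants cancel, leaving `x y (y - x)(d₄ e₃ - d₃
e₄)`; on the left only the commutator of `e₁` and `e₂` survives. -/
lemma rtt_linear_aux {K S : Type*} [CommRing K] [Ring S] [Algebra K S] (x y d₁ d₂ d₃ d₄ : K)
    {e₁ e₂ e₃ e₄ : S} (h : e₁ * e₂ - e₂ * e₁ = d₄ • e₃ - d₃ • e₄) :
    (y - x) • ((d₁ • 1 + x • e₁) * (d₂ • 1 + y • e₂) - (d₂ • 1 + y • e₂) * (d₁ • 1 + x • e₁)) =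
      (x * y) • ((d₄ • 1 + x • e₄) * (d₃ • 1 + y • e₃) -
        (d₄ • 1 + y • e₄) * (d₃ • 1 + x • e₃)) := by
  rw [sub_eq_iff_eq_add] at h
  simp only [add_mul, mul_add, smul_mul_assoc, mul_smul_comm, one_mul, mul_one, h]
  module

/-- The matrix `1 + E u⁻¹`. -/
def linearSeries (E : Matrix (Fin n) (Fin n) A) : (Matrix (Fin n) (Fin n) A)⟦X⟧ :=
  1 + PowerSeries.C E * PowerSeries.X

lemma matEquiv_symm_linearSeries_apply (E : Matrix (Fin n) (Fin n) A) (i j : Fin n) :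
    matEquiv.symm (linearSeries E) i j =
      (if i = j then 1 else 0) + PowerSeries.C (E i j) * PowerSeries.X := by
  ext r
  rw [coeff_matEquiv_symm, linearSeries]
  rcases r with _ | _ | r <;>
    simp [PowerSeries.coeff_one, Matrix.one_apply, apply_ite]
  split_ifs <;> simp_all

/-- `1 + E u⁻¹` satisfies the `RTT` relation if the entries of `E` satisfy the relations of the
matrix units. -/
lemma isRTT_linearSeries {E : Matrix (Fin n) (Fin n) A}
    (hE : ∀ i j r s, E i j * E r s - E r s * E i j =
      (if j = r then E i s else 0) - (if i = s then E r j else 0)) :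
    IsRTT (matEquiv.symm (linearSeries E)) := by
  rw [isRTT_iff]
  intro i j r s
  have hu (i j : Fin n) : inU (matEquiv.symm (linearSeries E) i j) =
      (if i = j then 1 else 0 : Subring.center A⟦X⟧⟦X⟧) • 1 +
        (uCen : Subring.center A⟦X⟧⟦X⟧) • inU (PowerSeries.C (E i j)) := by
    rw [matEquiv_symm_linearSeries_apply, map_add, map_mul, ← uInv, ← (commute_uInv _).eq,
      ← uCen_smul]
    split_ifs <;> simp
  have hv (i j : Fin n) : inV (matEquiv.symm (linearSeries E) i j) =
      (if i = j then 1 else 0 : Subring.center A⟦X⟧⟦X⟧) • 1 +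
        (vCen : Subring.center A⟦X⟧⟦X⟧) • inU (PowerSeries.C (E i j)) := by
    have : inU (PowerSeries.C (E i j)) = inV (PowerSeries.C (E i j)) := by
      rw [inU, inV, PowerSeries.map_C]
    rw [matEquiv_symm_linearSeries_apply, map_add, map_mul, ← vInv, ← (commute_vInv _).eq,
      this, ← vCen_smul]
    split_ifs <;> simp
  rw [hu, hu, hv, hv, hv, hu]
  refine rtt_linear_aux (uCen : Subring.center A⟦X⟧⟦X⟧) vCen _ _ _ _ ?_
  have hE' := congrArg (fun x : A => (inU (PowerSeries.C x) : A⟦X⟧⟦X⟧)) (hE i j r s)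
  simp only [map_sub, map_mul] at hE'
  rw [hE']
  congr 1
  · by_cases h : j = r
    · simp [h]
    · simp [h, Ne.symm h]
  · split_ifs <;> simp

end RTTConstructions

/-! ### Deformed oscillator representations of the Yangian -/

section WeylRepresentation

/-- Elements satisfying the canonical commutation relations. -/
structure WeylFamily (ι A : Type*) [DecidableEq ι] [Ring A] where
  /-- The positions. -/
  pos : ι → A
  /-- The momenta. -/
  mom : ι → A
  pos_comm : ∀ p q, pos p * pos q = pos q * pos p
  mom_comm : ∀ p q, mom p * mom q = mom q * mom p
  mom_mul_pos : ∀ p q, mom p * pos q = pos q * mom p + if p = q then 1 else 0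

/-- Multiplication by the variables and partial differentiation. -/
def weylOperators (ι : Type*) [DecidableEq ι] :
    WeylFamily ι (Module.End ℂ (MvPolynomial ι ℂ)) where
  pos p := LinearMap.mulLeft ℂ (MvPolynomial.X p)
  mom p := (MvPolynomial.pderiv p).toLinearMap
  pos_comm p q := LinearMap.ext fun f => mul_left_comm _ _ _
  mom_comm p q := by
    have h : ⁅(MvPolynomial.pderiv p : Derivation ℂ (MvPolynomial ι ℂ) (MvPolynomial ι ℂ)),
        (MvPolynomial.pderiv q : Derivation ℂ (MvPolynomial ι ℂ) (MvPolynomial ι ℂ))⁆ = 0 := by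
      refine MvPolynomial.derivation_ext fun i => ?_
      rw [Derivation.commutator_apply, MvPolynomial.pderiv_X, MvPolynomial.pderiv_X,
        Pi.single_apply, Pi.single_apply]
      split_ifs <;> simp
    refine LinearMap.ext fun f => ?_
    have := DFunLike.congr_fun h f
    rw [Derivation.commutator_apply] at this
    exact sub_eq_zero.1 this
  mom_mul_pos p q := by
    refine LinearMap.ext fun f => ?_
    have h : (MvPolynomial.pderiv p) (MvPolynomial.X q * f) =
        MvPolynomial.X q * (MvPolynomial.pderiv p) f + if p = q then f else 0 := by
      rw [MvPolynomial.pderiv_mul, MvPolynomial.pderiv_X, Pi.single_apply, add_comm]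
      congr 1
      by_cases h : p = q
      · simp [h]
      · simp [h, Ne.symm h]
    refine Eq.trans h ?_
    split_ifs <;> rfl

variable {n : ℕ} {A : Type*} [Ring A] [Algebra ℂ A] (W : WeylFamily (ℕ × Fin n) A)

/-- A deformation `λ c + x_p` of the multiplication operator. -/
def creation (p : ℕ × Fin n) (c : ℂ) : Polynomial A :=
  Polynomial.C (algebraMap ℂ A c) * Polynomial.X + Polynomial.C (W.pos p)

/-- A deformation `λ c + ∂_p` of the differentiation operator. -/
def annihilation (p : ℕ × Fin n) (c : ℂ) : Polynomial A :=
  Polynomial.C (algebraMap ℂ A c) * Polynomial.X + Polynomial.C (W.mom p)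

lemma commute_C_mul_X (c : ℂ) (f : Polynomial A) :
    Commute (Polynomial.C (algebraMap ℂ A c) * Polynomial.X) f := by
  refine Commute.mul_left ?_ (Polynomial.commute_X f)
  have : Polynomial.C (algebraMap ℂ A c) = algebraMap ℂ (Polynomial A) c :=
    (Polynomial.algebraMap_apply c).symm
  rw [this]
  exact Algebra.commutes c f

lemma creation_comm (p q : ℕ × Fin n) (c d : ℂ) :
    Commute (creation W p c) (creation W q d) := by
  refine Commute.add_left (commute_C_mul_X _ _) (Commute.add_right (commute_C_mul_X _ _).symm ?_)
  rw [Commute, SemiconjBy, ← map_mul, ← map_mul, W.pos_comm]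

lemma annihilation_comm (p q : ℕ × Fin n) (c d : ℂ) :
    Commute (annihilation W p c) (annihilation W q d) := by
  refine Commute.add_left (commute_C_mul_X _ _) (Commute.add_right (commute_C_mul_X _ _).symm ?_)
  rw [Commute, SemiconjBy, ← map_mul, ← map_mul, W.mom_comm]

/-- The shifts by `λ c` are central, so the canonical commutation relations are unchanged. -/
lemma annihilation_mul_creation (p q : ℕ × Fin n) (c d : ℂ) :
    annihilation W p c * creation W q d =
      creation W q d * annihilation W p c + if p = q then 1 else 0 := by
  have h1 := (commute_C_mul_X (A := A) c (Polynomial.C (W.pos q))).eq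
  have h2 := (commute_C_mul_X (A := A) d (Polynomial.C (W.mom p))).eq
  have h3 := (commute_C_mul_X (A := A) c (Polynomial.C (algebraMap ℂ A d) * Polynomial.X)).eq
  have h4 : Polynomial.C (W.mom p) * Polynomial.C (W.pos q) =
      Polynomial.C (W.pos q) * Polynomial.C (W.mom p) + if p = q then 1 else 0 := by
    rw [← map_mul, W.mom_mul_pos, map_add, map_mul, apply_ite Polynomial.C, map_one, map_zero]
  rw [annihilation, creation, add_mul, mul_add, mul_add, h1, h3, h4, ← h2]
  rw [add_mul, mul_add, mul_add]
  abel

/-- The `k`-th copy of the matrix of generators of `gl(n)`, acting by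
`E_ij = (λ a_i + x_ki) (λ b_j + ∂_kj)`. -/
def glMatrix (k : ℕ) (a b : Fin n → ℂ) : Matrix (Fin n) (Fin n) (Polynomial A) :=
  Matrix.of fun i j => creation W (k, i) (a i) * annihilation W (k, j) (b j)

/-- The oscillator realisation of `gl(n)`: after moving annihilators to the right, the quartic terms
cancel and the contractions give the matrix-unit relations. -/
lemma glMatrix_commutator (k : ℕ) (a b : Fin n → ℂ) (i j r s : Fin n) :
    glMatrix W k a b i j * glMatrix W k a b r s - glMatrix W k a b r s * glMatrix W k a b i j =
      (if j = r then glMatrix W k a b i s else 0) - (if i = s then glMatrix W k a b r j else 0) := by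
  simp only [glMatrix, Matrix.of_apply]
  have h1 := annihilation_mul_creation W (k, j) (k, r) (b j) (a r)
  have h2 := annihilation_mul_creation W (k, s) (k, i) (b s) (a i)
  have h3 := (creation_comm W (k, i) (k, r) (a i) (a r)).eq
  have h4 := (annihilation_comm W (k, j) (k, s) (b j) (b s)).eq
  have e1 : ((k, j) = (k, r)) ↔ j = r := by simp
  have e2 : ((k, s) = (k, i)) ↔ i = s := by simp [eq_comm]
  rw [if_congr e1 rfl rfl] at h1
  rw [if_congr e2 rfl rfl] at h2
  generalize creation W (k, i) (a i) = α at *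
  generalize creation W (k, r) (a r) = α' at *
  generalize annihilation W (k, j) (b j) = β at *
  generalize annihilation W (k, s) (b s) = β' at *
  have h5 : α * β * (α' * β') = α * (β * α') * β' := by simp only [mul_assoc]
  have h6 : α' * β' * (α * β) = α' * (β' * α) * β := by simp only [mul_assoc]
  rw [h5, h6, h1, h2]
  have h7 : α * (α' * β) * β' = α' * (α * β') * β := by
    rw [← mul_assoc, h3, mul_assoc, mul_assoc, h4]
    simp only [mul_assoc]
  rw [mul_add, mul_add, add_mul, add_mul, h7]
  split_ifs <;> simp [add_sub_add_left_eq_sub]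

lemma commute_glMatrix {k k' : ℕ} (h : k ≠ k') (a b a' b' : Fin n → ℂ) (i j r s : Fin n) :
    Commute (glMatrix W k a b i j) (glMatrix W k' a' b' r s) := by
  have h1 : Commute (annihilation W (k, j) (b j)) (creation W (k', r) (a' r)) := by
    have := annihilation_mul_creation W (k, j) (k', r) (b j) (a' r)
    rwa [if_neg (by simp [h]), add_zero] at this
  have h2 : Commute (annihilation W (k', s) (b' s)) (creation W (k, i) (a i)) := by
    have := annihilation_mul_creation W (k', s) (k, i) (b' s) (a i)
    rwa [if_neg (by simp [h.symm]), add_zero] at this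
  exact ((creation_comm W _ _ _ _).mul_right h2.symm).mul_left
    (h1.mul_right (annihilation_comm W _ _ _ _))

/-- Each entry is quadratic in `λ`, with top coefficient the rank-one matrix `a bᵀ`; hence weight
`r` is matched with degree `2r`. -/
lemma hasSymbol_glMatrix (k : ℕ) (a b : Fin n → ℂ) (i j : Fin n) :
    HasSymbol (glMatrix W k a b i j) 1 (a i * b j) := by
  have h1 : (creation W (k, i) (a i)).natDegree ≤ 1 := Polynomial.natDegree_linear_le
  have h2 : (annihilation W (k, j) (b j)).natDegree ≤ 1 := Polynomial.natDegree_linear_le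
  refine ⟨(Polynomial.natDegree_mul_le_of_le h1 h2).trans (by norm_num), ?_⟩
  rw [glMatrix, Matrix.of_apply, show 2 * 1 = 1 + 1 from rfl,
    Polynomial.coeff_mul_add_eq_of_natDegree_le h1 h2]
  simp [creation, annihilation, Polynomial.coeff_C]

/-- The product of the first `N` commuting copies of `1 + E u⁻¹`. -/
def tensorSeries (a b : ℕ → Fin n → ℂ) : ℕ → (Matrix (Fin n) (Fin n) (Polynomial A))⟦X⟧
  | 0 => 1
  | N + 1 => tensorSeries a b N * linearSeries (glMatrix W N (a N) (b N))

/-- The product of the first `N` factors `1 + a_k b_kᵀ u⁻¹`. -/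
def symbolSeries (a b : ℕ → Fin n → ℂ) : ℕ → (Matrix (Fin n) (Fin n) ℂ)⟦X⟧
  | 0 => 1
  | N + 1 => symbolSeries a b N * rankOneFactor (a N) (b N)

lemma constantCoeff_tensorSeries (a b : ℕ → Fin n → ℂ) (N : ℕ) :
    PowerSeries.constantCoeff (tensorSeries W a b N) = 1 := by
  induction N with
  | zero => exact map_one _
  | succ N ih => rw [tensorSeries, map_mul, ih]; simp [linearSeries]

lemma coeff_linearSeries_apply {A : Type*} [Ring A] (E : Matrix (Fin n) (Fin n) A)
    (r : ℕ) (i j : Fin n) :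
    PowerSeries.coeff r (linearSeries E) i j =
      (if r = 0 then (if i = j then 1 else 0) else 0) + if r = 1 then E i j else 0 := by
  rcases r with _ | _ | r <;>
    simp [linearSeries, PowerSeries.coeff_one, Matrix.one_apply]

lemma commute_tensorSeries (a b : ℕ → Fin n → ℂ) (N k : ℕ) (hk : N ≤ k) (r : ℕ) (i j s t : Fin n) :
    Commute (PowerSeries.coeff r (tensorSeries W a b N) i j) (glMatrix W k (a k) (b k) s t) := by
  induction N generalizing r i j with
  | zero =>
    rw [tensorSeries, PowerSeries.coeff_one]
    split_ifs
    · rw [Matrix.one_apply]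
      split_ifs
      exacts [Commute.one_left _, Commute.zero_left _]
    · exact Commute.zero_left _
  | succ N ih =>
    rw [tensorSeries, PowerSeries.coeff_mul, Matrix.sum_apply]
    refine Commute.sum_left _ _ _ fun x _ => ?_
    rw [Matrix.mul_apply]
    refine Commute.sum_left _ _ _ fun m _ => (ih (by omega) _ _ _).mul_left ?_
    rw [coeff_linearSeries_apply]
    refine Commute.add_left ?_ ?_
    · split_ifs
      exacts [Commute.one_left _, Commute.zero_left _, Commute.zero_left _]
    · split_ifs
      exacts [commute_glMatrix W (by omega) _ _ _ _ _ _ _ _, Commute.zero_left _]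

lemma isRTT_tensorSeries (a b : ℕ → Fin n → ℂ) (N : ℕ) :
    IsRTT (matEquiv.symm (tensorSeries W a b N)) := by
  induction N with
  | zero => rw [tensorSeries, map_one]; exact isRTT_one
  | succ N ih =>
    rw [tensorSeries, map_mul]
    refine ih.mul (isRTT_linearSeries (glMatrix_commutator W N (a N) (b N))) ?_
    intro i j k m r s
    rw [coeff_matEquiv_symm, coeff_matEquiv_symm, coeff_linearSeries_apply]
    refine Commute.add_right ?_ ?_
    · split_ifs
      exacts [Commute.one_right _, Commute.zero_right _, Commute.zero_right _]
    · split_ifs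
      exacts [commute_tensorSeries W a b N N le_rfl _ _ _ _ _, Commute.zero_right _]

end WeylRepresentation

/-! ### Symbols of series, products and inverses -/

section SeriesSymbols

variable {A : Type*} [Ring A] [Algebra ℂ A] {n : ℕ}

/-- All coefficients of the entries of `p` have the corresponding coefficients of `q` as symbols. -/
def SeriesSymbol (p : (Matrix (Fin n) (Fin n) (Polynomial A))⟦X⟧)
    (q : (Matrix (Fin n) (Fin n) ℂ)⟦X⟧) : Prop :=
  ∀ r i j, HasSymbol (PowerSeries.coeff r p i j) r (PowerSeries.coeff r q i j)

lemma SeriesSymbol.mul {p p' : (Matrix (Fin n) (Fin n) (Polynomial A))⟦X⟧}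
    {q q' : (Matrix (Fin n) (Fin n) ℂ)⟦X⟧} (h : SeriesSymbol p q) (h' : SeriesSymbol p' q') :
    SeriesSymbol (p * p') (q * q') := fun r i j => by
  rw [PowerSeries.coeff_mul, PowerSeries.coeff_mul, Matrix.sum_apply, Matrix.sum_apply]
  refine HasSymbol.sum fun x hx => ?_
  rw [Matrix.mul_apply, Matrix.mul_apply, ← Finset.HasAntidiagonal.mem_antidiagonal.1 hx]
  exact HasSymbol.sum fun k _ => (h _ _ _).mul (h' _ _ _)

lemma seriesSymbol_C {M : Matrix (Fin n) (Fin n) (Polynomial A)} {N : Matrix (Fin n) (Fin n) ℂ}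
    (h : ∀ i j, HasSymbol (M i j) 0 (N i j)) :
    SeriesSymbol (PowerSeries.C M) (PowerSeries.C N) := fun r i j => by
  rw [PowerSeries.coeff_C, PowerSeries.coeff_C]
  split_ifs with hr
  · subst hr
    exact h i j
  · exact hasSymbol_zero r

lemma seriesSymbol_one :
    SeriesSymbol (1 : (Matrix (Fin n) (Fin n) (Polynomial A))⟦X⟧) 1 := by
  rw [← map_one PowerSeries.C, ← map_one PowerSeries.C]
  refine seriesSymbol_C fun i j => ?_
  rw [Matrix.one_apply, Matrix.one_apply]
  split_ifs
  exacts [hasSymbol_one, hasSymbol_zero 0]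

lemma SeriesSymbol.negArg {p : (Matrix (Fin n) (Fin n) (Polynomial A))⟦X⟧}
    {q : (Matrix (Fin n) (Fin n) ℂ)⟦X⟧} (h : SeriesSymbol p q) :
    SeriesSymbol (negArg p) (negArg q) := fun r i j => by
  rw [coeff_negArg, coeff_negArg]
  rcases Nat.even_or_odd r with hr | hr
  · rw [hr.neg_one_pow, hr.neg_one_pow, one_mul, one_mul]
    exact h r i j
  · rw [hr.neg_one_pow, hr.neg_one_pow, neg_one_mul, neg_one_mul]
    exact (h r i j).neg

/-- The recursion for the inverse series; it lets `SeriesSymbol.inverse` transfer symbols to the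
inverse by strong induction on the order. -/
lemma coeff_inverse_apply {S : Type*} [Ring S] {f g : (Matrix (Fin n) (Fin n) S)⟦X⟧}
    (hf : PowerSeries.constantCoeff f = 1) (hfg : f * g = 1) (r : ℕ) (i j : Fin n) :
    PowerSeries.coeff r g i j = PowerSeries.coeff r (1 : (Matrix (Fin n) (Fin n) S)⟦X⟧) i j -
      ∑ k ∈ Finset.range r, ∑ m,
        PowerSeries.coeff (k + 1) f i m * PowerSeries.coeff (r - (k + 1)) g m j := by
  rw [← hfg, PowerSeries.coeff_mul, Finset.Nat.sum_antidiagonal_eq_sum_range_succ_mk,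
    Finset.sum_range_succ', PowerSeries.coeff_zero_eq_constantCoeff_apply, hf, one_mul,
    Nat.sub_zero, Matrix.add_apply, Matrix.sum_apply]
  simp only [Matrix.mul_apply]
  exact (add_sub_cancel_left _ _).symm

lemma SeriesSymbol.inverse {p p' : (Matrix (Fin n) (Fin n) (Polynomial A))⟦X⟧}
    {q q' : (Matrix (Fin n) (Fin n) ℂ)⟦X⟧} (h : SeriesSymbol p q)
    (hp0 : PowerSeries.constantCoeff p = 1) (hq0 : PowerSeries.constantCoeff q = 1)
    (hp : p * p' = 1) (hq : q * q' = 1) : SeriesSymbol p' q' := fun r => by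
  induction r using Nat.strong_induction_on with
  | _ r ih =>
    intro i j
    rw [coeff_inverse_apply hp0 hp r i j, coeff_inverse_apply hq0 hq r i j, sub_eq_add_neg,
      sub_eq_add_neg]
    refine (seriesSymbol_one r i j).add (HasSymbol.neg ?_)
    refine HasSymbol.sum fun k hk => HasSymbol.sum fun m _ => ?_
    rw [Finset.mem_range] at hk
    have := (h (k + 1) i m).mul (ih (r - (k + 1)) (by omega) m j)
    rwa [Nat.add_sub_of_le (by omega)] at this

lemma seriesSymbol_tensorSeries (W : WeylFamily (ℕ × Fin n) A) (a b : ℕ → Fin n → ℂ) (N : ℕ) :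
    SeriesSymbol (tensorSeries W a b N) (symbolSeries a b N) := by
  induction N with
  | zero => exact seriesSymbol_one
  | succ N ih =>
    refine ih.mul fun r i j => ?_
    change HasSymbol _ _ (PowerSeries.coeff r (linearSeries (Matrix.vecMulVec (a N) (b N))) i j)
    rw [coeff_linearSeries_apply, coeff_linearSeries_apply]
    rcases r with _ | _ | r
    · simp only [if_true, zero_ne_one, if_false, add_zero]
      split_ifs
      exacts [hasSymbol_one, hasSymbol_zero 0]
    · simpa [Matrix.vecMulVec_apply] using hasSymbol_glMatrix W N (a N) (b N) i j
    · simpa using hasSymbol_zero _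

lemma exists_symbolSeries_eq {q : (Matrix (Fin n) (Fin n) ℂ)⟦X⟧} (hq : q ∈ rankOneProducts n) :
    ∃ a b N, symbolSeries a b N = q := by
  have hcongr {a b a' b' : ℕ → Fin n → ℂ} (N : ℕ) (ha : ∀ k < N, a k = a' k)
      (hb : ∀ k < N, b k = b' k) : symbolSeries a b N = symbolSeries a' b' N := by
    induction N with
    | zero => rfl
    | succ N ih =>
      rw [symbolSeries, symbolSeries, ih (fun k hk => ha k (by omega)) fun k hk => hb k (by omega),
        ha N (by omega), hb N (by omega)]
  -- Factors are appended on the right, as in `symbolSeries`. Updating `a` and `b` at `N` leaves the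
  -- first `N` factors alone.
  induction hq using Submonoid.closure_induction_right with
  | one => exact ⟨0, 0, 0, rfl⟩
  | mul_right p _ q hq ih =>
    obtain ⟨a, b, N, rfl⟩ := ih
    obtain ⟨x, y, rfl⟩ := hq
    refine ⟨Function.update a N x, Function.update b N y, N + 1, ?_⟩
    rw [symbolSeries, Function.update_self, Function.update_self]
    congr 1
    exact hcongr N (fun k hk => Function.update_of_ne hk.ne _ _)
      fun k hk => Function.update_of_ne hk.ne _ _

end SeriesSymbols

/-! ### Symbols of the image of `φ` -/

section Embedding

variable {n l : ℕ}

lemma constantCoeff_conjugate {A : Type*} [Ring A] {T T' : Matrix (Fin n) (Fin n) A⟦X⟧}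
    (hT : T.map PowerSeries.constantCoeff = 1) (h : T * T' = 1) :
    (T * matG n l A⟦X⟧ * T'.map negArg).map PowerSeries.constantCoeff = matG n l A := by
  have h' : T'.map PowerSeries.constantCoeff = 1 := by
    have := congrArg (fun N => N.map (PowerSeries.constantCoeff : A⟦X⟧ →+* A)) h
    rwa [Matrix.map_mul, hT, one_mul, Matrix.map_one _ (map_zero _) (map_one _)] at this
  have h'' : (T'.map negArg).map (PowerSeries.constantCoeff : A⟦X⟧ →+* A) = 1 := by
    rw [← h']
    ext1 i j
    simp
  rw [Matrix.map_mul, Matrix.map_mul, hT, map_matG, h'', one_mul, mul_one]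

lemma matEquiv_matG {A : Type*} [Ring A] :
    matEquiv (matG n l A⟦X⟧) = PowerSeries.C (matG n l A) := by
  ext r i j
  rw [coeff_matEquiv, PowerSeries.coeff_C, matG, matG, Matrix.diagonal_apply]
  rcases r with _ | r
  · rw [if_pos rfl, Matrix.diagonal_apply]
    split_ifs <;> simp
  · rw [if_neg r.succ_ne_zero, Matrix.zero_apply]
    split_ifs <;> simp [PowerSeries.coeff_one]

/-- A homomorphism from the Yangian for which the symbols of the generators of the reflection
algebra are prescribed. -/
lemma exists_yangian_symbols {φ : ReflAlg n l →ₐ[ℂ] Yangian n} (hφ : SendsBToTGT n l φ)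
    (d : ℕ) (τ : FreeIndex n l → ℂ) :
    ∃ ρ : Yangian n →ₐ[ℂ] Polynomial (Module.End ℂ (MvPolynomial (ℕ × Fin n) ℂ)),
      ∀ g, genWt n l g ≤ d → HasSymbol (ρ (φ (freeGen n l g))) (genWt n l g) (τ g) := by
  obtain ⟨q, q', hq, hqq, hτ⟩ := exists_rankOneProducts_coeff_eq l τ d
  obtain ⟨a, b, N, rfl⟩ := exists_symbolSeries_eq hq
  set p := tensorSeries (weylOperators (ℕ × Fin n)) a b N with hp
  have hp0 : PowerSeries.constantCoeff p = 1 := constantCoeff_tensorSeries _ a b N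
  have hp1 : (matEquiv.symm p).map PowerSeries.constantCoeff = 1 := by
    rw [← hp0]
    ext1 i j
    rw [Matrix.map_apply, ← PowerSeries.coeff_zero_eq_constantCoeff_apply, coeff_matEquiv_symm,
      PowerSeries.coeff_zero_eq_constantCoeff_apply]
  obtain ⟨ρ, hρ⟩ := exists_yangian_lift (isRTT_tensorSeries _ a b N) hp1
  have hu := isUnit_of_constantCoeff_matrix (constantCoeff_matT n)
  have hTT := Ring.mul_inverse_cancel _ hu
  -- The image of `T⁻¹(u)` under `ρ`; only `p * p' = 1` is needed to find its symbol.
  set p' := matEquiv ((Ring.inverse (matT n)).map (PowerSeries.map ρ.toRingHom)) with hp'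
  have hpp : p * p' = 1 := by
    have := congrArg (fun N => N.map (PowerSeries.map ρ.toRingHom)) hTT
    rw [Matrix.map_mul, hρ, Matrix.map_one _ (map_zero _) (map_one _)] at this
    have := congrArg matEquiv this
    rwa [map_mul, RingEquiv.apply_symm_apply, map_one] at this
  have hs := seriesSymbol_tensorSeries (weylOperators (ℕ × Fin n)) a b N
  have hs' := hs.inverse hp0 (constantCoeff_rankOneProducts hq) hpp hqq
  have hG : SeriesSymbol (A := Module.End ℂ (MvPolynomial (ℕ × Fin n) ℂ))
      (PowerSeries.C (matG n l _)) (PowerSeries.C (matG n l ℂ)) := by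
    refine seriesSymbol_C fun i j => ?_
    rw [matG, matG, Matrix.diagonal_apply, Matrix.diagonal_apply]
    split_ifs
    exacts [hasSymbol_one, hasSymbol_one.neg, hasSymbol_zero 0]
  have hmain := (hs.mul hG).mul hs'.negArg
  -- Under `ρ ∘ φ` the matrix `B(u)` becomes `p(u) G p'(-u)`, whose symbol is `q(u) G q'(-u)`.
  have hB : matEquiv (((matB n l).map (PowerSeries.map φ.toRingHom)).map
      (PowerSeries.map ρ.toRingHom)) = p * PowerSeries.C (matG n l _) * negArg p' := by
    rw [hφ, Matrix.map_mul, Matrix.map_mul, hρ, map_map_negArg, map_mul, map_mul,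
      RingEquiv.apply_symm_apply, matEquiv_map_negArg, map_matG, matEquiv_matG]
  refine ⟨ρ, fun g hg => ?_⟩
  have := hmain (g.1.2.2 + 1) g.1.1 g.1.2.1
  rw [hτ g hg, ← hp, ← hB, coeff_matEquiv] at this
  exact this

end Embedding

end ReflectionAlgebra

end

open ReflectionAlgebra in
theorem theorem3p1 (n l : ℕ) (hl : l ≤ n) :
    IsUnit (matT n) ∧
    ∃ φ : ReflAlg n l →ₐ[ℂ] Yangian n,
      SendsBToTGT n l φ ∧
      (∀ ψ : ReflAlg n l →ₐ[ℂ] Yangian n, SendsBToTGT n l ψ → ψ = φ) ∧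
      Function.Injective φ := by
  have hu := isUnit_of_constantCoeff_matrix (constantCoeff_matT n)
  have h1 := Ring.mul_inverse_cancel _ hu
  have h2 := Ring.inverse_mul_cancel _ hu
  obtain ⟨φ, hφ⟩ := exists_reflAlg_lift ((isRTT_matT n).reflection h1 h2 l)
    (constantCoeff_conjugate (constantCoeff_matT n) h1) (unitary_of_inverse h1 h2 l)
  refine ⟨hu, φ, hφ, fun ψ hψ => algHom_ext_of_generic (hψ.trans hφ.symm), ?_⟩
  rw [injective_iff_map_eq_zero]
  intro z hz
  obtain ⟨d, hd⟩ := exists_mem_filt z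
  -- Every `ρ ∘ φ` kills `z`, and `ρ` can be chosen to give the free generators arbitrary symbols up
  -- to any weight.
  refine eq_zero_of_symbols (A := Module.End ℂ (MvPolynomial (ℕ × Fin n) ℂ))
    commutator_freeGen (fun d τ => ?_) d hd
  obtain ⟨ρ, hρ⟩ := exists_yangian_symbols hφ d τ
  exact ⟨ρ.comp φ, by rw [AlgHom.comp_apply, hz, map_zero], hρ⟩
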